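/- Let $A=\mathbb C[t_1^{\pm1},t_2^{\pm1}]$ and let $\mathcal L=\operatorname{Der}A$ be the Lie algebra of $\mathbb C$-linear derivations of $A$. For $\alpha=(\alpha_1,\alpha_2)\in\mathbb Z^2$ and $i\in\{1,2\}$ put $d_i(\alpha)=t_1^{\alpha_1}t_2^{\alpha_2}\,t_i\frac{\partial}{\partial t_i}$ and $\mathcal L_\alpha=\mathbb C d_1(\alpha)\oplus\mathbb C d_2(\alpha)$. Order $\mathbb Z^2$ lexicographically ($\alpha>0$ if the first nonzero entry of $\alpha$ is positive), and let $\mathcal L^+=\bigoplus_{\alpha>0}\mathcal L_\alpha$ and $\mathfrak b^-=\bigoplus_{\alpha\le 0}\mathcal L_\alpha$. Let $\varepsilon_2=(0,1)$ and $z=d_1(0)\in\mathfrak b^-$. Let $\psi:\mathcal L^+\to\mathbb C$ be a homomorphism of Lie algebras which is nonsingular, that is, $\psi(d_1(\varepsilon_2))$, $\psi(d_2(\varepsilon_2))$ and $\psi(d_2(2\varepsilon_2))$ are all nonzero. Let $\mathbb C_\psi$ be the one-dimensional $\mathcal L^+$-module on which $x\in\mathcal L^+$ acts as the scalar $\psi(x)$,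 let $W_\psi=U(\mathcal L)\otimes_{U(\mathcal L^+)}\mathbb C_\psi$, and let $w=1\otimes1$. A nonzero vector $v$ of an $\mathcal L$-module is called a Whittaker vector of type $\psi'$, where $\psi':\mathcal L^+\to\mathbb C$ is a homomorphism of Lie algebras, if $xv=\psi'(x)v$ for all $x\in\mathcal L^+$; it is called a Whittaker vector if it is one of some type. Theorem. For every nonzero $u\in U(\mathfrak b^-)$, the vector $uw\in W_\psi$ is a Whittaker vector if and only if $u\in\mathbb C[z]$, the subalgebra of $U(\mathfrak b^-)$ generated by $z$. Moreover, every Whittaker vector of $W_\psi$ is of type $\psi$. -/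

import Mathlib

/- Associative rings (here `ℂ` and enveloping algebras) carry the commutator bracket;
in particular `ℂ` is the one-dimensional abelian Lie algebra. -/
attribute [local instance 100] LieRing.ofAssociativeRing

noncomputable section

open TensorProduct

namespace DerTorus

/-- The algebra `ℂ[t₁^{±1}, t₂^{±1}]` of Laurent polynomials in two variables.  The monomial
`t^α = t₁^{α 0} t₂^{α 1}` is `AddMonoidAlgebra.single α 1`. -/
abbrev Laurent : Type := AddMonoidAlgebra ℂ (Fin 2 → ℤ)

/-- The Lie algebra `𝓛 = Der ℂ[t₁^{±1}, t₂^{±1}]` of all `ℂ`-derivations, with the commutator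
bracket. -/
abbrev Der : Type := Derivation ℂ Laurent Laurent

/-- The linear map `t^α ↦ α_i t^α`. -/
def eulerLinear (i : Fin 2) : Laurent →ₗ[ℂ] Laurent :=
  (AddMonoidAlgebra.coeffLinearEquiv ℂ).symm.toLinearMap ∘ₗ
    (Finsupp.lsum ℂ fun α : Fin 2 → ℤ => ((α i : ℤ) : ℂ) • Finsupp.lsingle α) ∘ₗ
    (AddMonoidAlgebra.coeffLinearEquiv ℂ).toLinearMap

theorem eulerLinear_single (i : Fin 2) (α : Fin 2 → ℤ) (c : ℂ) :
    eulerLinear i (AddMonoidAlgebra.single α c) =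
      AddMonoidAlgebra.single α ((α i : ℂ) * c) := by
  apply AddMonoidAlgebra.coeff_injective
  simp [eulerLinear]

/-- The derivation `t_i ∂/∂t_i`. -/
def euler (i : Fin 2) : Der :=
  Derivation.mk' (eulerLinear i) (by
    intro a b
    induction a using AddMonoidAlgebra.induction_linear with
    | zero => simp
    | add f g hf hg => simp only [add_mul, map_add, hf, hg, smul_eq_mul, mul_add]; ring
    | single α r =>
      induction b using AddMonoidAlgebra.induction_linear with
      | zero => simp
      | add f g hf hg =>
        simp only [mul_add, map_add, hf, hg, smul_eq_mul]; ring
      | single β s =>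
        simp only [AddMonoidAlgebra.single_mul_single, eulerLinear_single, smul_eq_mul,
          add_comm β α, ← AddMonoidAlgebra.single_add]
        congr 1
        simp only [Pi.add_apply]
        push_cast
        ring)

/-- The derivation `d_i(α) = t^α (t_i ∂/∂t_i)`; the indices `0, 1 : Fin 2` stand for `1, 2`. -/
def d (i : Fin 2) (α : Fin 2 → ℤ) : Der :=
  (AddMonoidAlgebra.single α (1 : ℂ) : Laurent) • euler i

theorem d_apply_single (i : Fin 2) (α β : Fin 2 → ℤ) (c : ℂ) :
    d i α (AddMonoidAlgebra.single β c) =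
      AddMonoidAlgebra.single (α + β) ((β i : ℂ) * c) := by
  change AddMonoidAlgebra.single α (1 : ℂ) * eulerLinear i (AddMonoidAlgebra.single β c) = _
  rw [eulerLinear_single, AddMonoidAlgebra.single_mul_single, one_mul]

theorem d_lie_d (i j : Fin 2) (α β : Fin 2 → ℤ) :
    ⁅d i α, d j β⁆ = (β i : ℂ) • d j (α + β) - (α j : ℂ) • d i (α + β) := by
  apply Derivation.ext
  intro f
  induction f using AddMonoidAlgebra.induction_linear with
  | zero => simp
  | add f g hf hg => simp only [map_add, hf, hg]
  | single γ c =>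
    simp only [Derivation.commutator_apply, Derivation.sub_apply, Derivation.smul_apply,
      d_apply_single, AddMonoidAlgebra.smul_single, smul_eq_mul]
    rw [show β + (α + γ) = α + β + γ by abel, show α + (β + γ) = α + β + γ by abel,
      ← AddMonoidAlgebra.single_sub, ← AddMonoidAlgebra.single_sub]
    congr 1
    simp only [Pi.add_apply]
    push_cast
    ring

/-- `α > 0` in the lexicographic order of `ℤ²`: the first nonzero entry of `α` is positive. -/
def LexPos (α : Fin 2 → ℤ) : Prop := 0 < α 0 ∨ (α 0 = 0 ∧ 0 < α 1)

/-- `α ≤ 0` in the lexicographic order of `ℤ²`. -/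
def LexNonpos (α : Fin 2 → ℤ) : Prop := α = 0 ∨ LexPos (-α)

/-- The Lie subalgebra `⨁_{α ∈ S} 𝓛_α`, where `𝓛_α = ℂ d₁(α) ⊕ ℂ d₂(α)`, for a set `S` of
degrees that is closed under addition. -/
def gradedPart (S : Set (Fin 2 → ℤ)) (hS : ∀ α ∈ S, ∀ β ∈ S, α + β ∈ S) :
    LieSubalgebra ℂ Der where
  toSubmodule := Submodule.span ℂ {x | ∃ i, ∃ α ∈ S, d i α = x}
  lie_mem' := by
    intro x y hx hy
    simp only [AddSubsemigroup.mem_carrier, AddSubmonoid.mem_toSubsemigroup,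
      Submodule.mem_toAddSubmonoid] at hx hy ⊢
    induction hx, hy using Submodule.span_induction₂ with
    | mem_mem x y hx hy =>
      obtain ⟨i, α, hα, rfl⟩ := hx
      obtain ⟨j, β, hβ, rfl⟩ := hy
      rw [d_lie_d]
      exact sub_mem
        (Submodule.smul_mem _ _ (Submodule.subset_span ⟨j, _, hS _ hα _ hβ, rfl⟩))
        (Submodule.smul_mem _ _ (Submodule.subset_span ⟨i, _, hS _ hα _ hβ, rfl⟩))
    | zero_left y hy => simp
    | zero_right x hx => simp
    | add_left x y z _ _ _ h₁ h₂ => rw [add_lie]; exact add_mem h₁ h₂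
    | add_right x y z _ _ _ h₁ h₂ => rw [lie_add]; exact add_mem h₁ h₂
    | smul_left r x y _ _ h => rw [smul_lie]; exact Submodule.smul_mem _ _ h
    | smul_right r x y _ _ h => rw [lie_smul]; exact Submodule.smul_mem _ _ h

theorem lexPos_add {α β : Fin 2 → ℤ} (hα : LexPos α) (hβ : LexPos β) : LexPos (α + β) := by
  simp only [LexPos, Pi.add_apply] at *
  omega

theorem lexNonpos_add {α β : Fin 2 → ℤ} (hα : LexNonpos α) (hβ : LexNonpos β) :
    LexNonpos (α + β) := by
  rcases hα with rfl | hα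
  · simpa using hβ
  rcases hβ with rfl | hβ
  · rw [add_zero]; exact Or.inr hα
  right
  rw [neg_add]
  exact lexPos_add hα hβ

/-- `𝓛⁺ = ⨁_{α > 0} 𝓛_α`. -/
def Lplus : LieSubalgebra ℂ Der :=
  gradedPart {α | LexPos α} fun _ hα _ hβ => lexPos_add hα hβ

/-- `𝔟⁻ = 𝓛⁻ ⊕ 𝔥 = ⨁_{α ≤ 0} 𝓛_α`. -/
def bminus : LieSubalgebra ℂ Der :=
  gradedPart {α | LexNonpos α} fun _ hα _ hβ => lexNonpos_add hα hβ

/-- `d_i(α)` as an element of `𝓛⁺`, for `α > 0`. -/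
def dPlus (i : Fin 2) (α : Fin 2 → ℤ) (hα : LexPos α) : Lplus :=
  ⟨d i α, Submodule.subset_span ⟨i, α, hα, rfl⟩⟩

/-- `z = d₁(0)` as an element of `𝔟⁻`. -/
def z : bminus :=
  ⟨d 0 0, Submodule.subset_span ⟨0, 0, Or.inl rfl, rfl⟩⟩

/-- A Lie homomorphism `ψ : 𝓛⁺ → ℂ` is nonsingular if it does not vanish at
`d₁(ε₂)`, `d₂(ε₂)` and `d₂(2ε₂)`, where `ε₂ = (0, 1)`. -/
def Nonsingular (ψ : Lplus →ₗ⁅ℂ⁆ ℂ) : Prop :=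
  ψ (dPlus 0 ![0, 1] (by simp [LexPos])) ≠ 0 ∧
  ψ (dPlus 1 ![0, 1] (by simp [LexPos])) ≠ 0 ∧
  ψ (dPlus 1 ![0, 2] (by simp [LexPos])) ≠ 0

/-- The vector `v` of an `𝓛`-module is a Whittaker vector of type `ψ`. -/
def IsWhittakerVectorOfType {V : Type*} [AddCommGroup V] [Module ℂ V] [LieRingModule Der V]
    (ψ : Lplus →ₗ⁅ℂ⁆ ℂ) (v : V) : Prop :=
  v ≠ 0 ∧ ∀ x : Lplus, ⁅(x : Der), v⁆ = ψ x • v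

/-- The vector `v` of an `𝓛`-module is a Whittaker vector (of some type). -/
def IsWhittakerVector {V : Type*} [AddCommGroup V] [Module ℂ V] [LieRingModule Der V]
    (v : V) : Prop :=
  ∃ ψ : Lplus →ₗ⁅ℂ⁆ ℂ, IsWhittakerVectorOfType ψ v

/-- The enveloping algebra `U(𝓛)`. -/
abbrev UDer : Type := UniversalEnvelopingAlgebra ℂ Der

/-- The algebra map `U(K) → U(𝓛)` induced by the inclusion of a Lie subalgebra `K`. -/
def envIncl (K : LieSubalgebra ℂ Der) : UniversalEnvelopingAlgebra ℂ K →ₐ[ℂ] UDer :=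
  UniversalEnvelopingAlgebra.lift ℂ ((UniversalEnvelopingAlgebra.ι ℂ).comp K.incl)

/-- The left `U(𝓛)`-submodule of `U(𝓛) ⊗_ℂ ℂ_ψ` generated by the elements
`us ⊗ c - u ⊗ s·c` for `u ∈ U(𝓛)`, `s ∈ U(𝓛⁺)`, `c ∈ ℂ_ψ`.  Here `s·c` is the action of
`U(𝓛⁺)` on `ℂ_ψ`, which extends `x·c = ψ(x)c` for `x ∈ 𝓛⁺`. -/
def balancingRelations (ψ : Lplus →ₗ⁅ℂ⁆ ℂ) : Submodule UDer (UDer ⊗[ℂ] ℂ) :=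
  Submodule.span UDer
    {y | ∃ (u : UDer) (s : UniversalEnvelopingAlgebra ℂ Lplus) (c : ℂ),
      y = (u * envIncl Lplus s) ⊗ₜ[ℂ] c -
        u ⊗ₜ[ℂ] (UniversalEnvelopingAlgebra.lift ℂ ψ s * c)}

/-- The induced module `W_ψ = U(𝓛) ⊗_{U(𝓛⁺)} ℂ_ψ`. -/
def Whittaker (ψ : Lplus →ₗ⁅ℂ⁆ ℂ) : Type := (UDer ⊗[ℂ] ℂ) ⧸ balancingRelations ψ

instance (ψ : Lplus →ₗ⁅ℂ⁆ ℂ) : AddCommGroup (Whittaker ψ) :=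
  inferInstanceAs (AddCommGroup ((UDer ⊗[ℂ] ℂ) ⧸ balancingRelations ψ))

instance (ψ : Lplus →ₗ⁅ℂ⁆ ℂ) : Module UDer (Whittaker ψ) :=
  inferInstanceAs (Module UDer ((UDer ⊗[ℂ] ℂ) ⧸ balancingRelations ψ))

instance (ψ : Lplus →ₗ⁅ℂ⁆ ℂ) : Module ℂ (Whittaker ψ) :=
  inferInstanceAs (Module ℂ ((UDer ⊗[ℂ] ℂ) ⧸ balancingRelations ψ))

instance (ψ : Lplus →ₗ⁅ℂ⁆ ℂ) : IsScalarTower ℂ UDer (Whittaker ψ) :=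
  inferInstanceAs (IsScalarTower ℂ UDer ((UDer ⊗[ℂ] ℂ) ⧸ balancingRelations ψ))

/-- `W_ψ` as an `𝓛`-module: `x ∈ 𝓛` acts as its image in `U(𝓛)`. -/
instance (ψ : Lplus →ₗ⁅ℂ⁆ ℂ) : LieRingModule Der (Whittaker ψ) where
  bracket x v := UniversalEnvelopingAlgebra.ι ℂ x • v
  add_lie x y v := by
    change UniversalEnvelopingAlgebra.ι ℂ (x + y) • v =
      UniversalEnvelopingAlgebra.ι ℂ x • v + UniversalEnvelopingAlgebra.ι ℂ y • v
    rw [map_add, add_smul]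
  lie_add x v w := smul_add _ v w
  leibniz_lie x y v := by
    change UniversalEnvelopingAlgebra.ι ℂ x • UniversalEnvelopingAlgebra.ι ℂ y • v =
      UniversalEnvelopingAlgebra.ι ℂ ⁅x, y⁆ • v +
        UniversalEnvelopingAlgebra.ι ℂ y • UniversalEnvelopingAlgebra.ι ℂ x • v
    rw [LieHom.map_lie, LieRing.of_associative_ring_bracket, sub_smul, mul_smul, mul_smul,
      sub_add_cancel]

theorem lie_eq_ι_smul (ψ : Lplus →ₗ⁅ℂ⁆ ℂ) (x : Der) (v : Whittaker ψ) :
    ⁅x, v⁆ = UniversalEnvelopingAlgebra.ι ℂ x • v := rfl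

instance (ψ : Lplus →ₗ⁅ℂ⁆ ℂ) : LieModule ℂ Der (Whittaker ψ) where
  smul_lie t x v := by
    rw [lie_eq_ι_smul, lie_eq_ι_smul, map_smul, smul_assoc]
  lie_smul t x v := by
    rw [lie_eq_ι_smul, lie_eq_ι_smul, ← algebraMap_smul UDer t v, ← mul_smul,
      ← Algebra.commutes, mul_smul, algebraMap_smul]

/-- The cyclic Whittaker vector `w = 1 ⊗ 1` of `W_ψ`. -/
def cyclicVector (ψ : Lplus →ₗ⁅ℂ⁆ ℂ) : Whittaker ψ :=
  (balancingRelations ψ).mkQ ((1 : UDer) ⊗ₜ[ℂ] (1 : ℂ))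

end DerTorus

end

/-!
The proof works with leading symbols of the elements of `W_ψ`, which are polynomials in variables
`X b` that correspond to the basis elements `d_i(α)`, `α ≤ 0`, of `𝔟⁻`.

*The Poincaré–Birkhoff–Witt theorem.*  `𝓛` acts by derivations on the ring of matrix coefficients
of endomorphisms of the Laurent polynomials, and at the identity this ring has local coordinates
dual to the `d_i(α)`.  The pairing of a word in the `d_i(α)` with a monomial in the coordinates
vanishes if the monomial has more factors than the word, and if the numbers agree it is nonzero
exactly if word and monomial have the same letters.  Hence words with distinct multisets of letters
are linearly independent in `U(𝓛)` (`linearIndependent_words`).  It follows that `U(𝓛)` is free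
as a right `U(𝓛⁺)`-module on the monomials of `U(𝔟⁻)`, so that `u ↦ uw` is injective on `U(𝔟⁻)`
and the polynomial ring parametrizes `W_ψ` (`ofPoly`).

*Symbols.*  Let the letters have weights such that commutators have smaller weight than the product
of the two letters.  Then, modulo terms of smaller weight, an element of `𝓛⁺` acts on `W_ψ` by its
value under `ψ` plus a derivation of the polynomial ring (`smul_ofSymbol_sub_mem_map`).  Two choices
of weights are used.

With all weights equal to one, the derivations give the action of `𝓛⁺` on `S(𝓛/𝓛⁺)`.  It strictly
raises degrees, so that all its eigenvalues are zero; this shows that Whittaker vectors have type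
`ψ` (`eq_of_isWhittakerVectorOfType`).  Moreover the operators `d₁(0, k)` with `k` large move every
variable of degree `α` with `α₁ < 0` to a new variable, so the leading symbol of a Whittaker vector
contains no such variable.  As the grading operator of the first degree preserves Whittaker vectors,
the whole polynomial of a Whittaker vector contains none (`fst_eq_zero_of_whittaker`).

On the subalgebra of degrees `(0, m)`, let `d₁` have weight zero and `d₂` weight one.  Now `ψ`
contributes to the derivations, and `d₁(0, m + 1)` maps `X d₂(0, -m)` to a nonzero multiple of
`ψ(d₁(0, 1))`.  This excludes the variables `d₂(0, -m)` from the polynomial of a Whittaker vector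
(`idx_eq_zero_of_whittaker`), and `d₂(0, m + 1)` excludes the `d₁(0, -m)` with `m > 0` in the same
way (`eq_zero_of_whittaker`).  Only `z = d₁(0)` remains.  Conversely `ℂ[z]w` consists of Whittaker
vectors since `[x, z] = -α₁x` for `x ∈ 𝓛_α`, and `ψ` vanishes on `𝓛_α` if `α₁ > 0`.
-/

noncomputable section

open TensorProduct

namespace DerTorus

/-! ### Straightening words in a filtered algebra -/

section Straightening

variable {R U V J : Type*} [CommRing R] [Ring U] [Algebra R U] [AddCommGroup V] [Module R V]
  [Module U V]

/-- The span of the vectors `E j₁ ⋯ E jₙ • w`, where all letters `jᵢ` lie in `A` and the total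
weight `f j₁ + ⋯ + f jₙ` is less than `r`. -/
def wordFiltration (R : Type*) [CommRing R] [Algebra R U] [Module R V] (E : J → U) (w : V)
    (A : Set J) (f : J → ℕ) (r : ℕ) : Submodule R V :=
  Submodule.span R {v | ∃ l : List J, (∀ j ∈ l, j ∈ A) ∧ (l.map f).sum < r ∧
    (l.map E).prod • w = v}

/-- Commutators of the letters in `A` are linear combinations of letters of `A` of weight smaller
than the sum of the two weights, so that the filtration of words by weight has a commutative
associated graded ring. -/
def CommutatorsLower (R : Type*) [CommRing R] [Algebra R U] (E : J → U)
    (A : Set J) (f : J → ℕ) : Prop :=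
  ∀ i ∈ A, ∀ j ∈ A, E i * E j - E j * E i ∈
    Submodule.span R {x | ∃ k ∈ A, f k < f i + f j ∧ E k = x}

variable {E : J → U} {w : V} {A : Set J} {f : J → ℕ}

theorem word_mem_wordFiltration {r : ℕ} {l : List J} (hl : ∀ j ∈ l, j ∈ A)
    (hr : (l.map f).sum < r) : (l.map E).prod • w ∈ wordFiltration R E w A f r :=
  Submodule.subset_span ⟨l, hl, hr, rfl⟩

theorem wordFiltration_mono {r s : ℕ} (h : r ≤ s) :
    wordFiltration R E w A f r ≤ wordFiltration R E w A f s := by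
  apply Submodule.span_mono
  rintro _ ⟨l, hl, hr, rfl⟩
  exact ⟨l, hl, hr.trans_le h, rfl⟩

variable (E w) in
/-- The linear map that sends a monomial in the commuting variables `X b`, `b ∈ B`, to the
corresponding product of the operators `E b`, in a fixed order, applied to `w`. -/
def ofSymbol (R : Type*) [CommRing R] [Algebra R U] [Module R V] (B : Set J) :
    MvPolynomial B R →ₗ[R] V :=
  (MvPolynomial.basisMonomials B R).constr R fun s =>
    ((Finsupp.toMultiset s).toList.map fun b : B => E b).prod • w

theorem ofSymbol_monomial {B : Set J} (s : B →₀ ℕ) :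
    ofSymbol E w R B (MvPolynomial.monomial s 1) =
      ((Finsupp.toMultiset s).toList.map fun b : B => E b).prod • w := by
  have : MvPolynomial.monomial s 1 = MvPolynomial.basisMonomials B R s := by simp
  rw [ofSymbol, this, Module.Basis.constr_basis]

open Classical in
/-- The symbol of a letter: a variable for a letter in `B`; a letter outside `B`, which acts on
`w` by the scalar `χ j`, contributes that scalar if its weight is zero, and otherwise vanishes in
the associated graded module. -/
def letterSymbol (f : J → ℕ) (χ : J → R) (B : Set J) (j : J) : MvPolynomial B R :=
  if h : j ∈ B then MvPolynomial.X ⟨j, h⟩ else if f j = 0 then MvPolynomial.C (χ j) else 0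

variable {B : Set J} {χ : J → R}

theorem letterSymbol_of_mem {j : J} (h : j ∈ B) :
    letterSymbol f χ B j = MvPolynomial.X ⟨j, h⟩ := by
  rw [letterSymbol, dif_pos h]

variable [IsScalarTower R U V]

theorem smul_mem_wordFiltration {r : ℕ} {i : J} (hi : i ∈ A) {v : V}
    (hv : v ∈ wordFiltration R E w A f r) : E i • v ∈ wordFiltration R E w A f (f i + r) := by
  induction hv using Submodule.span_induction with
  | mem v hv =>
    obtain ⟨l, hl, hr, rfl⟩ := hv
    rw [← mul_smul, ← List.prod_cons, ← List.map_cons (f := E)]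
    exact word_mem_wordFiltration (by simpa using ⟨hi, hl⟩) (by simpa using hr)
  | zero => simp
  | add x y _ _ hx hy => rw [smul_add]; exact add_mem hx hy
  | smul c x _ hx => rw [smul_algebra_smul_comm]; exact Submodule.smul_mem _ _ hx

/-- If `x` is a linear combination of letters of weight less than `s`, then replacing one letter
of a word by `x` produces an element of the expected step of the filtration. -/
theorem smul_word_mem_wordFiltration {r s : ℕ} {x : U} {l : List J} (hl : ∀ j ∈ l, j ∈ A)
    (hx : x ∈ Submodule.span R {x | ∃ k ∈ A, f k < s ∧ E k = x})
    (hr : s + (l.map f).sum ≤ r) :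
    x • (l.map E).prod • w ∈ wordFiltration R E w A f r := by
  induction hx using Submodule.span_induction with
  | mem x hx =>
    obtain ⟨k, hk, hks, rfl⟩ := hx
    rw [← mul_smul, ← List.prod_cons, ← List.map_cons (f := E)]
    exact word_mem_wordFiltration (by simpa using ⟨hk, hl⟩)
      (by simp only [List.map_cons, List.sum_cons]; omega)
  | zero => simp
  | add x y _ _ hx hy => rw [add_smul]; exact add_mem hx hy
  | smul c x _ hx => rw [smul_assoc]; exact Submodule.smul_mem _ _ hx

/-- Permuting the letters of a word changes it by words of smaller weight. -/
theorem word_sub_word_mem_of_perm (hE : CommutatorsLower R E A f) {l₁ l₂ : List J}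
    (h : l₁.Perm l₂) (hl : ∀ j ∈ l₁, j ∈ A) :
    (l₁.map E).prod • w - (l₂.map E).prod • w ∈
      wordFiltration R E w A f (l₁.map f).sum := by
  induction h with
  | nil => simp
  | cons x h ih =>
    simp only [List.map_cons, List.prod_cons, List.sum_cons, mul_smul, ← smul_sub]
    exact smul_mem_wordFiltration (hl _ (by simp)) (ih fun j hj => hl j (by simp [hj]))
  | swap x y l =>
    simp only [List.map_cons, List.prod_cons, List.sum_cons, mul_smul]
    rw [← mul_smul (E y), ← mul_smul (E x), ← sub_smul]
    exact smul_word_mem_wordFiltration (fun j hj => hl j (by simp [hj]))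
      (hE y (hl _ (by simp)) x (hl _ (by simp))) (by omega)
  | trans h₁ h₂ ih₁ ih₂ =>
    have h₃ := ih₂ fun j hj => hl j (h₁.mem_iff.2 hj)
    rw [← (h₁.map f).sum_eq] at h₃
    have := add_mem (ih₁ hl) h₃
    rwa [sub_add_sub_cancel] at this

/-- A set of words that contains a rearrangement of every word spans all words: this is the
spanning half of the Poincaré–Birkhoff–Witt theorem. -/
theorem word_mem_span_of_perm (hE : CommutatorsLower R E Set.univ fun _ => 1)
    {T : Set (List J)} (hT : ∀ l : List J, ∃ l' ∈ T, l.Perm l') (l : List J) :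
    (l.map E).prod ∈ Submodule.span R ((fun l => (l.map E).prod) '' T) := by
  induction hn : l.length using Nat.strong_induction_on generalizing l with
  | _ n ih =>
    obtain ⟨l', hl', hp⟩ := hT l
    have h := word_sub_word_mem_of_perm (w := (1 : U)) hE hp (by simp)
    simp only [smul_eq_mul, mul_one] at h
    rw [← sub_add_cancel (l.map E).prod (l'.map E).prod]
    refine add_mem ?_ (Submodule.subset_span ⟨l', hl', rfl⟩)
    refine (Submodule.span_le.2 ?_ : wordFiltration R E (1 : U) _ _ _ ≤ _) h
    rintro _ ⟨m, -, hm, rfl⟩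
    simp only [List.map_const', List.sum_replicate, smul_eq_mul, mul_one] at hm ⊢
    exact ih m.length (hn ▸ hm) m rfl

theorem word_sub_ofSymbol_mem_of_forall_mem (hE : CommutatorsLower R E A f) (l : List B)
    (hl : ∀ j ∈ l, (j : J) ∈ A) :
    (l.map fun b : B => E b).prod • w -
        ofSymbol E w R B (l.map fun b : B => MvPolynomial.X b).prod ∈
      wordFiltration R E w A f (l.map fun b : B => f b).sum := by
  classical
  have h1 : (l.map fun b : B => MvPolynomial.X (R := R) b).prod =
      MvPolynomial.monomial (Multiset.toFinsupp (l : Multiset B)) 1 := by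
    induction l with
    | nil => simp
    | cons a l ih =>
      rw [List.map_cons, List.prod_cons, ih fun j hj => hl j (by simp [hj]), MvPolynomial.X,
        MvPolynomial.monomial_mul, one_mul, ← Multiset.cons_coe, ← Multiset.singleton_add,
        map_add, Multiset.toFinsupp_singleton]
  have hp : (l.map ((↑) : B → J)).Perm ((l : Multiset B).toList.map (↑)) := by
    apply List.Perm.map
    rw [← Multiset.coe_eq_coe, Multiset.coe_toList]
  have := word_sub_word_mem_of_perm (w := w) hE hp (by simpa using fun j h hj => hl _ hj)
  rw [h1, ofSymbol_monomial, Multiset.toFinsupp_toMultiset]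
  simpa [Function.comp_def] using this

/-- Modulo words of smaller weight, a word in all letters applied to `w` depends only on the
product of the symbols of its letters. -/
theorem word_sub_ofSymbol_mem (hE : CommutatorsLower R E A f)
    (hw : ∀ j ∉ B, E j • w = χ j • w) (l : List J) (hl : ∀ j ∈ l, j ∈ A) :
    (l.map E).prod • w - ofSymbol E w R B (l.map (letterSymbol f χ B)).prod ∈
      wordFiltration R E w A f (l.map f).sum := by
  induction hn : l.length generalizing l with
  | zero =>
    obtain rfl := List.length_eq_zero_iff.1 hn
    simpa using word_sub_ofSymbol_mem_of_forall_mem (B := B) (w := w) hE [] (by simp)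
  | succ n ih =>
    by_cases hB : ∀ j ∈ l, j ∈ B
    · lift l to List B using hB
      have h1 : (l.map (↑)).map (letterSymbol f χ B) =
          l.map fun b : B => MvPolynomial.X (R := R) b := by
        rw [List.map_map]
        exact List.map_congr_left fun b _ => letterSymbol_of_mem b.2
      rw [h1]
      simpa [Function.comp_def] using
        word_sub_ofSymbol_mem_of_forall_mem (w := w) hE l (by simpa using hl)
    push Not at hB
    -- A letter outside `B` can be moved to the right end, where it acts on `w` as a scalar.
    obtain ⟨n₀, hn₀, hn₀B⟩ := hB
    obtain ⟨l', hl'⟩ : ∃ l', l.Perm (l' ++ [n₀]) := by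
      obtain ⟨a, b, rfl⟩ := List.append_of_mem hn₀
      exact ⟨a ++ b, by
        rw [List.append_assoc]
        exact (List.Perm.append_left a (List.perm_append_singleton n₀ b).symm)⟩
    have hlen : l'.length = n := by
      have := hl'.length_eq
      simp at this
      omega
    have hA : ∀ j ∈ l', j ∈ A := fun j hj => hl j (hl'.mem_iff.2 (by simp [hj]))
    have h1 := word_sub_word_mem_of_perm (w := w) hE hl' hl
    have h2 := ih l' hA hlen
    have hf : (l.map f).sum = (l'.map f).sum + f n₀ := by
      rw [(hl'.map f).sum_eq]; simp
    have h3 : (l.map (letterSymbol f χ B)).prod =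
        letterSymbol f χ B n₀ * (l'.map (letterSymbol f χ B)).prod := by
      rw [(hl'.map _).prod_eq]; simp [mul_comm]
    rw [← sub_add_sub_cancel _ ((List.map E (l' ++ [n₀])).prod • w)]
    refine add_mem h1 ?_
    have h4 : (List.map E (l' ++ [n₀])).prod • w = χ n₀ • (l'.map E).prod • w := by
      simp only [List.map_append, List.map_cons, List.map_nil, List.prod_append, List.prod_cons,
        List.prod_nil, mul_one, mul_smul, hw n₀ hn₀B]
      rw [smul_algebra_smul_comm]
    rw [h3, h4, hf, letterSymbol, dif_neg hn₀B]
    split_ifs with h0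
    · rw [MvPolynomial.C_mul', map_smul, ← smul_sub, h0, add_zero]
      exact Submodule.smul_mem _ _ h2
    · rw [zero_mul, map_zero, sub_zero]
      exact Submodule.smul_mem _ _ (word_mem_wordFiltration hA (by omega))

/-- The exponents of the monomials in variables from `A` whose weight is less than `r`. -/
def lowExponents (A : Set J) (f : J → ℕ) (B : Set J) (r : ℕ) : Set (B →₀ ℕ) :=
  {s | (∀ b ∈ s.support, (b : J) ∈ A) ∧ Finsupp.weight (fun b : B => f b) s < r}

theorem prod_letterSymbol_mem (l : List J) (hl : ∀ j ∈ l, j ∈ A) :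
    (l.map (letterSymbol f χ B)).prod ∈
      MvPolynomial.restrictSupport R (lowExponents A f B ((l.map f).sum + 1)) := by
  classical
  induction l with
  | nil =>
    rw [List.map_nil, List.map_nil, List.prod_nil, ← MvPolynomial.C_1, MvPolynomial.C_apply,
      MvPolynomial.monomial_mem_restrictSupport]
    left
    simp [lowExponents]
  | cons j l ih =>
    have ih := ih fun i hi => hl i (by simp [hi])
    rw [List.map_cons, List.map_cons, List.prod_cons, List.sum_cons]
    by_cases hj : j ∈ B
    · rw [letterSymbol_of_mem hj, MvPolynomial.mem_restrictSupport_iff]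
      intro s hs
      rw [Finset.mem_coe, mul_comm, MvPolynomial.support_mul_X, Finset.mem_map] at hs
      obtain ⟨t, ht, rfl⟩ := hs
      obtain ⟨h1, h2⟩ := (MvPolynomial.mem_restrictSupport_iff _).1 ih ht
      refine ⟨fun b hb => ?_, ?_⟩
      · rcases Finset.mem_union.1 (Finsupp.support_add hb) with h | h
        · exact h1 b h
        · obtain rfl := Finset.mem_singleton.1 (Finsupp.support_single_subset h)
          exact hl j (by simp)
      · simp only [addRightEmbedding_apply, map_add, Finsupp.weight_single, one_smul]
        omega
    · rw [letterSymbol, dif_neg hj]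
      split_ifs with h0
      · rw [MvPolynomial.C_mul', h0, zero_add]
        exact Submodule.smul_mem _ _ ih
      · simp

/-- Every word of weight less than `r` applied to `w` comes from a polynomial of weight less than
`r`. -/
theorem wordFiltration_le_map (hE : CommutatorsLower R E A f)
    (hw : ∀ j ∉ B, E j • w = χ j • w) (r : ℕ) :
    wordFiltration R E w A f r ≤
      (MvPolynomial.restrictSupport R (lowExponents A f B r)).map (ofSymbol E w R B) := by
  induction r using Nat.strong_induction_on with
  | _ r ih =>
    refine Submodule.span_le.2 ?_
    rintro _ ⟨l, hl, hr, rfl⟩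
    have hmono : ∀ s ≤ r,
        MvPolynomial.restrictSupport R (lowExponents A f B s) ≤
          MvPolynomial.restrictSupport R (lowExponents A f B r) := fun s hs =>
      MvPolynomial.restrictSupport_mono _ fun t ht => ⟨ht.1, ht.2.trans_le hs⟩
    rw [SetLike.mem_coe, ← sub_add_cancel ((l.map E).prod • w)
      (ofSymbol E w R B (l.map (letterSymbol f χ B)).prod)]
    refine add_mem (Submodule.map_mono (hmono _ hr.le)
      (ih _ hr (word_sub_ofSymbol_mem hE hw l hl)))
      (Submodule.mem_map_of_mem (hmono _ hr (prod_letterSymbol_mem l hl)))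

/-- The commutator with `E n` acts on words as a derivation, and modulo words of smaller weight
it is computed by the derivation of the polynomial ring with values `g b`, if `g b` is the symbol
of the commutator of `E n` and `E b`. -/
theorem commutator_word_sub_ofSymbol_mem (hE : CommutatorsLower R E A f)
    (hw : ∀ j ∉ B, E j • w = χ j • w) {n : J} {g : B → MvPolynomial B R}
    (hg : ∀ b : B, (b : J) ∈ A → (E n * E b - E b * E n, g b) ∈
      Submodule.span R {x : U × MvPolynomial B R |
        ∃ k ∈ A, f k < f n + f b ∧ (E k, letterSymbol f χ B k) = x})
    (l₀ l : List B) (hl₀ : ∀ j ∈ l₀, (j : J) ∈ A) (hl : ∀ j ∈ l, (j : J) ∈ A) :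
    (l₀.map fun b : B => E b).prod •
        (E n * (l.map fun b : B => E b).prod - (l.map fun b : B => E b).prod * E n) • w -
      ofSymbol E w R B ((l₀.map MvPolynomial.X).prod *
        MvPolynomial.mkDerivation R g (l.map MvPolynomial.X).prod) ∈
      wordFiltration R E w A f
        ((l₀.map fun b : B => f b).sum + (l.map fun b : B => f b).sum + f n - 1) := by
  induction l generalizing l₀ with
  | nil => simp
  | cons b l ih =>
    have hb := hl b (by simp)
    have hl' : ∀ j ∈ l, (j : J) ∈ A := fun j hj => hl j (by simp [hj])
    have h1 := ih (l₀ ++ [b]) (by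
      intro j hj
      rcases List.mem_append.1 hj with h | h
      · exact hl₀ j h
      · obtain rfl := List.mem_singleton.1 h
        exact hb) hl'
    have h2 : ∀ y : U × MvPolynomial B R, y ∈ Submodule.span R {x : U × MvPolynomial B R |
        ∃ k ∈ A, f k < f n + f b ∧ (E k, letterSymbol f χ B k) = x} →
        ((l₀.map fun b : B => E b).prod * y.1 * (l.map fun b : B => E b).prod) • w -
          ofSymbol E w R B ((l₀.map MvPolynomial.X).prod * y.2 * (l.map MvPolynomial.X).prod) ∈
          wordFiltration R E w A f
            ((l₀.map fun b : B => f b).sum + ((b :: l).map fun b : B => f b).sum + f n - 1) := by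
      intro y hy
      induction hy using Submodule.span_induction with
      | mem y hy =>
        obtain ⟨k, hk, hkf, rfl⟩ := hy
        have := word_sub_ofSymbol_mem hE hw (l₀.map (↑) ++ k :: l.map (↑)) (by
          intro j hj
          simp only [List.mem_append, List.mem_cons, List.mem_map] at hj
          rcases hj with ⟨j, h, rfl⟩ | rfl | ⟨j, h, rfl⟩
          exacts [hl₀ j h, hk, hl' j h])
        have hX : ∀ m : List B, (m.map (↑)).map (letterSymbol f χ B) =
            m.map MvPolynomial.X := fun m => by
          rw [List.map_map]
          exact List.map_congr_left fun b _ => letterSymbol_of_mem b.2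
        simp only [List.map_append, List.map_cons, List.prod_append, List.prod_cons, hX,
          List.sum_append, List.sum_cons, ← mul_assoc] at this
        simp only [List.map_map] at this
        refine wordFiltration_mono ?_ this
        simp only [List.map_cons, List.sum_cons, Function.comp_def]
        omega
      | zero => simp
      | add x y _ _ hx hy =>
        have := add_mem hx hy
        rw [← add_sub_add_comm, ← add_smul, ← map_add] at this
        simpa only [Prod.fst_add, Prod.snd_add, mul_add, add_mul] using this
      | smul c x _ hx =>
        have := Submodule.smul_mem _ c hx
        rw [smul_sub, ← smul_assoc, ← map_smul] at this
        simpa only [Prod.smul_fst, Prod.smul_snd, mul_smul_comm, smul_mul_assoc] using this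
    have h3 := add_mem (h2 _ (hg b hb)) (wordFiltration_mono (by simp; omega) h1)
    rw [← add_sub_add_comm, ← map_add, ← mul_smul, ← add_smul] at h3
    rw [← mul_smul]
    convert h3 using 3
    · simp only [List.map_append, List.map_cons, List.prod_append, List.prod_cons, List.map_nil,
        List.prod_nil]
      noncomm_ring
    · simp only [List.map_append, List.map_cons, List.prod_append, List.prod_cons, List.map_nil,
        List.prod_nil, Derivation.leibniz, smul_eq_mul, MvPolynomial.mkDerivation_X]
      ring

/-- If the commutators of `E n` with the letters have the symbols `g b`, then `E n`, up to the
scalar `χ n`, acts on symbols by the derivation with values `g b`. -/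
theorem smul_ofSymbol_sub_mem_map (hE : CommutatorsLower R E A f)
    (hw : ∀ j ∉ B, E j • w = χ j • w) {n : J} (hn : n ∉ B) {g : B → MvPolynomial B R}
    (hg : ∀ b : B, (b : J) ∈ A → (E n * E b - E b * E n, g b) ∈
      Submodule.span R {x : U × MvPolynomial B R |
        ∃ k ∈ A, f k < f n + f b ∧ (E k, letterSymbol f χ B k) = x})
    {r : ℕ} {p : MvPolynomial B R}
    (hp : p ∈ MvPolynomial.restrictSupport R (lowExponents A f B (r + 1))) :
    E n • ofSymbol E w R B p - χ n • ofSymbol E w R B p -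
        ofSymbol E w R B (MvPolynomial.mkDerivation R g p) ∈
      (MvPolynomial.restrictSupport R (lowExponents A f B (r + f n - 1))).map
        (ofSymbol E w R B) := by
  classical
  rw [MvPolynomial.restrictSupport_eq_span] at hp
  induction hp using Submodule.span_induction with
  | mem p hp =>
    obtain ⟨s, hs, rfl⟩ := hp
    have h1 : ((Finsupp.toMultiset s).toList.map MvPolynomial.X).prod =
        MvPolynomial.monomial (R := R) s 1 := by
      rw [MvPolynomial.monomial_eq, MvPolynomial.C_1, one_mul, ← Multiset.prod_coe,
        ← Multiset.map_coe, Multiset.coe_toList, Finsupp.toMultiset_map, Finsupp.prod_toMultiset,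
        Finsupp.prod_mapDomain_index (by simp) (by simp [pow_add])]
    have h2 : ((Finsupp.toMultiset s).toList.map fun b : B => f b).sum =
        Finsupp.weight (fun b : B => f b) s := by
      rw [← Multiset.sum_coe, ← Multiset.map_coe, Multiset.coe_toList, Finsupp.toMultiset_map,
        Finsupp.weight_apply, Finsupp.sum_toMultiset,
        Finsupp.sum_mapDomain_index (by simp) (by simp [add_mul])]
    have h3 := commutator_word_sub_ofSymbol_mem hE hw hg [] (Finsupp.toMultiset s).toList
      (by simp) (by
        intro j hj
        rw [Multiset.mem_toList, Finsupp.mem_toMultiset] at hj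
        exact hs.1 j hj)
    rw [h1, h2] at h3
    simp only [List.map_nil, List.prod_nil, one_smul, one_mul, List.sum_nil, zero_add,
      sub_smul, mul_smul, hw n hn] at h3
    rw [smul_algebra_smul_comm, ← ofSymbol_monomial (R := R)] at h3
    refine wordFiltration_le_map hE hw _ (wordFiltration_mono ?_ h3)
    have := hs.2
    omega
  | zero => simp
  | add x y _ _ hx hy =>
    have := add_mem hx hy
    simp only [map_add, smul_add]
    convert this using 1
    abel
  | smul c x _ hx =>
    have := Submodule.smul_mem _ c hx
    convert this using 1
    rw [map_smul]
    rw [smul_algebra_smul_comm, smul_comm (χ n), smul_sub, smul_sub, Derivation.map_smul, map_smul]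

end Straightening

/-! ### Linear independence of words in `U(𝓛)` -/

section Pairing

variable {K S J : Type*} [Field K] [CommRing S] [Algebra K S]
  {D : J → Derivation K S S} {ev : S →ₐ[K] K} {φ : J → S}

theorem derivation_apply_mem_pow (D : Derivation K S S) (I : Ideal S) {n : ℕ} {x : S}
    (hx : x ∈ I ^ (n + 1)) : D x ∈ I ^ n := by
  induction n generalizing x with
  | zero => simp
  | succ n ih =>
    rw [pow_succ] at hx
    induction hx using Submodule.mul_induction_on' with
    | mem_mul_mem a ha b hb =>
      rw [Derivation.leibniz, smul_eq_mul, smul_eq_mul]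
      refine add_mem (Ideal.mul_mem_right _ _ ha) ?_
      rw [pow_succ']
      exact Ideal.mul_mem_mul hb (ih ha)
    | add a _ b _ ha hb => rw [map_add]; exact add_mem ha hb

theorem word_apply_mem_pow (D : J → Derivation K S S) (I : Ideal S) (l : List J) {n : ℕ} {x : S}
    (hx : x ∈ I ^ n) :
    (l.map fun j => (D j : Module.End K S)).prod x ∈ I ^ (n - l.length) := by
  induction l with
  | nil => simpa using hx
  | cons j l ih =>
    rw [List.map_cons, List.prod_cons, Module.End.mul_apply, List.length_cons]
    by_cases h : n ≤ l.length
    · rw [Nat.sub_eq_zero_of_le (by omega)]; simp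
    · apply derivation_apply_mem_pow
      rwa [show n - (l.length + 1) + 1 = n - l.length by omega]

/-- Modulo higher powers of the maximal ideal, `D i` differentiates monomials in the local
coordinates `φ` like the partial derivative with respect to the `i`-th coordinate. -/
theorem derivation_prod_sub_mem_pow (h0 : ∀ j, ev (φ j) = 0) [DecidableEq J]
    (h1 : ∀ i j, ev (D i (φ j)) = if i = j then 1 else 0) (i : J) (T : Multiset J) :
    D i (T.map φ).prod - (T.count i : S) * ((T.erase i).map φ).prod ∈
      RingHom.ker ev ^ T.card := by
  induction T using Multiset.induction_on with
  | empty => simp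
  | cons a T ih =>
    set I := RingHom.ker ev
    have hφ : φ a ∈ I := by rw [RingHom.mem_ker]; exact h0 a
    have hT : ∀ T : Multiset J, (T.map φ).prod ∈ I ^ T.card := fun T => by
      induction T using Multiset.induction_on with
      | empty => simp
      | cons b T ih =>
        rw [Multiset.map_cons, Multiset.prod_cons, Multiset.card_cons, pow_succ']
        exact Ideal.mul_mem_mul (by rw [RingHom.mem_ker]; exact h0 b) ih
    have h2 : φ a * (D i (T.map φ).prod - (T.count i : S) * ((T.erase i).map φ).prod) ∈
        I ^ (T.card + 1) := by
      rw [pow_succ']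
      exact Ideal.mul_mem_mul hφ ih
    have h3 : (D i (φ a) - if i = a then 1 else 0) ∈ I := by
      rw [RingHom.mem_ker, map_sub, h1]
      split_ifs <;> simp
    have h4 := Ideal.mul_mem_mul (hT T) h3
    rw [← pow_succ] at h4
    have h5 := add_mem h2 h4
    rw [Multiset.card_cons]
    convert h5 using 1
    rw [Multiset.map_cons, Multiset.prod_cons, Derivation.leibniz, smul_eq_mul, smul_eq_mul]
    by_cases hia : i = a
    · subst hia
      rw [if_pos rfl, Multiset.count_cons_self, Multiset.erase_cons_head]
      by_cases hi : i ∈ T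
      · have : φ i * ((T.erase i).map φ).prod = (T.map φ).prod := by
          rw [← Multiset.prod_cons, ← Multiset.map_cons, Multiset.cons_erase hi]
        push_cast
        linear_combination (T.count i : S) * this
      · rw [Multiset.count_eq_zero_of_notMem hi]
        push_cast
        ring
    · rw [if_neg hia, Multiset.count_cons_of_ne hia, Multiset.erase_cons_tail _ (Ne.symm hia),
        Multiset.map_cons, Multiset.prod_cons]
      ring

variable [CharZero K]

/-- The pairing of a word of length `n` with a monomial of degree `n` in local coordinates is
nonzero exactly if the letters of the word are the factors of the monomial. -/
theorem ev_word_prod_ne_zero_iff (h0 : ∀ j, ev (φ j) = 0) [DecidableEq J]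
    (h1 : ∀ i j, ev (D i (φ j)) = if i = j then 1 else 0) (l : List J) (T : Multiset J)
    (hT : T.card = l.length) :
    ev ((l.map fun j => (D j : Module.End K S)).prod (T.map φ).prod) ≠ 0 ↔ T = l := by
  induction l using List.reverseRecOn generalizing T with
  | nil =>
    rw [List.length_nil, Multiset.card_eq_zero] at hT
    simp [hT]
  | append_singleton l i ih =>
    rw [List.length_append, List.length_singleton] at hT
    have h2 := word_apply_mem_pow D _ l (derivation_prod_sub_mem_pow h0 h1 i T)
    rw [hT, Nat.add_sub_cancel_left, pow_one, RingHom.mem_ker, map_sub, map_sub, sub_eq_zero] at h2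
    have h3 : (l ++ [i] : List J) = (i ::ₘ (l : Multiset J)) := by
      rw [Multiset.cons_coe, Multiset.coe_eq_coe]
      exact List.perm_append_singleton i l
    rw [List.map_append, List.prod_append, List.map_singleton, List.prod_singleton,
      Module.End.mul_apply, Derivation.coeFn_coe, h2, ← nsmul_eq_mul, map_nsmul, map_nsmul, h3]
    by_cases hi : i ∈ T
    · obtain ⟨T, rfl⟩ := Multiset.exists_cons_of_mem hi
      rw [Multiset.cons_inj_right, ← ih T (by simpa using hT)]
      have : (T.count i : K) + 1 ≠ 0 := by exact_mod_cast (T.count i).succ_ne_zero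
      simp [this]
    · rw [Multiset.count_eq_zero_of_notMem hi]
      simp only [zero_smul, ne_eq, not_true_eq_false, false_iff]
      rintro rfl
      simp at hi

/-- Words whose multisets of letters are distinct are linearly independent, as soon as the
letters act by derivations on a commutative algebra that has local coordinates at some point dual
to the letters. -/
theorem linearIndependent_words_of_derivations (h0 : ∀ j, ev (φ j) = 0) [DecidableEq J]
    (h1 : ∀ i j, ev (D i (φ j)) = if i = j then 1 else 0) {α : Type*} {l : α → List J}
    (hl : Function.Injective fun a => (l a : Multiset J)) :
    LinearIndependent K fun a => ((l a).map fun j => (D j : Module.End K S)).prod := by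
  rw [linearIndependent_iff]
  intro c hc
  by_contra hne
  -- Among the words of maximal length, the coefficient of one is detected by the monomial with
  -- the same letters.
  obtain ⟨a, ha, hmax⟩ := Finset.exists_max_image c.support (fun a => (l a).length)
    (Finsupp.support_nonempty_iff.2 hne)
  have h2 := congrArg (fun F : Module.End K S => ev (F ((l a : Multiset J).map φ).prod)) hc
  simp only [Finsupp.linearCombination_apply, Finsupp.sum, LinearMap.coe_sum, Finset.sum_apply,
    LinearMap.smul_apply, map_sum, map_smul, LinearMap.zero_apply, map_zero] at h2
  rw [Finset.sum_eq_single a] at h2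
  · have h3 := (ev_word_prod_ne_zero_iff h0 h1 (l a) (l a) (by simp)).2 rfl
    rw [smul_eq_mul, mul_eq_zero] at h2
    exact h2.elim (Finsupp.mem_support_iff.1 ha) h3
  · intro b hb hba
    rw [smul_eq_mul]
    refine mul_eq_zero_of_right _ ?_
    rcases (hmax b hb).lt_or_eq with hlt | heq
    · have hT : ((l a : Multiset J).map φ).prod ∈ RingHom.ker ev ^ (l a).length := by
        rw [← Multiset.coe_card]
        generalize (l a : Multiset J) = T
        induction T using Multiset.induction_on with
        | empty => simp
        | cons b T ih =>
          rw [Multiset.map_cons, Multiset.prod_cons, Multiset.card_cons, pow_succ']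
          exact Ideal.mul_mem_mul (by rw [RingHom.mem_ker]; exact h0 b) ih
      have := word_apply_mem_pow D _ (l b) hT
      exact Ideal.pow_le_self (by omega) this
    · by_contra hne'
      exact hba (hl ((ev_word_prod_ne_zero_iff h0 h1 (l b) (l a) (by simpa using heq.symm)).1
        hne').symm)
  · exact fun h => absurd ha h

end Pairing

/-- The indices of the basis `d_i(α)` of `Der ℂ[t₁^{±1}, t₂^{±1}]`. -/
abbrev Idx : Type := Fin 2 × (Fin 2 → ℤ)

/-- The basis element `d_i(α)`. -/
def dIdx (j : Idx) : Der := d j.1 j.2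

/-- The coordinate ring of the space of linear endomorphisms of the Laurent polynomials: the
variable `(β, γ)` is the coefficient of `t^γ` in the image of `t^β`. -/
abbrev MatrixCoeff : Type := MvPolynomial ((Fin 2 → ℤ) × (Fin 2 → ℤ)) ℂ

/-- The linear map `t^β ↦ X (β, γ)`, that is, the function that takes an endomorphism to the
coefficient of `t^γ` in the image of a given Laurent polynomial. -/
def matrixCoeff (γ : Fin 2 → ℤ) : Laurent →ₗ[ℂ] MatrixCoeff :=
  (Finsupp.lsum ℂ fun β : Fin 2 → ℤ =>
    (LinearMap.id : ℂ →ₗ[ℂ] ℂ).smulRight (MvPolynomial.X (R := ℂ) (β, γ))) ∘ₗ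
    (AddMonoidAlgebra.coeffLinearEquiv ℂ).toLinearMap

theorem matrixCoeff_single (β γ : Fin 2 → ℤ) (c : ℂ) :
    matrixCoeff γ (AddMonoidAlgebra.single β c) = c • MvPolynomial.X (β, γ) := by
  simp [matrixCoeff]

/-- A derivation of the Laurent polynomials acts by composition on endomorphisms, hence as a
derivation on the ring of their matrix coefficients. -/
def matrixAction (D : Der) : Derivation ℂ MatrixCoeff MatrixCoeff :=
  MvPolynomial.mkDerivation ℂ fun x => matrixCoeff x.2 (D (AddMonoidAlgebra.single x.1 1))

theorem matrixAction_matrixCoeff (D : Der) (γ : Fin 2 → ℤ) (a : Laurent) :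
    matrixAction D (matrixCoeff γ a) = matrixCoeff γ (D a) := by
  induction a using AddMonoidAlgebra.induction_linear with
  | zero => simp
  | add f g hf hg => simp only [map_add, hf, hg]
  | single β c =>
    have : (AddMonoidAlgebra.single β c : Laurent) = c • AddMonoidAlgebra.single β 1 := by
      simp
    rw [this, map_smul, Derivation.map_smul, Derivation.map_smul, map_smul, matrixCoeff_single,
      one_smul, matrixAction, MvPolynomial.mkDerivation_X]

/-- The action on matrix coefficients as a homomorphism of Lie algebras. -/
def matrixRep : Der →ₗ⁅ℂ⁆ Module.End ℂ MatrixCoeff where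
  toFun D := matrixAction D
  map_add' D D' := by
    rw [← Derivation.coe_add_linearMap]
    congr 1
    ext x
    simp [matrixAction]
  map_smul' c D := by
    rw [← Derivation.coe_smul_linearMap]
    congr 1
    ext x
    simp [matrixAction]
  map_lie' {D D'} := by
    rw [← Derivation.commutator_coe_linear_map]
    congr 1
    apply MvPolynomial.derivation_ext
    intro x
    have hx : MvPolynomial.X x = matrixCoeff x.2 (AddMonoidAlgebra.single x.1 1) := by
      rw [matrixCoeff_single, one_smul]
    rw [hx, Derivation.commutator_apply, matrixAction_matrixCoeff, matrixAction_matrixCoeff,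
      matrixAction_matrixCoeff, matrixAction_matrixCoeff, matrixAction_matrixCoeff,
      Derivation.commutator_apply, map_sub]

/-- Evaluation of matrix coefficients at the identity endomorphism. -/
def evalOne : MatrixCoeff →ₐ[ℂ] ℂ :=
  MvPolynomial.aeval fun x => if x.1 = x.2 then 1 else 0

/-- Local coordinates of the space of endomorphisms at the identity that are dual to the
derivations `d_i(α)`. -/
def localCoord (j : Idx) : MatrixCoeff :=
  MvPolynomial.X (Pi.single j.1 1, j.2 + Pi.single j.1 1) -
    MvPolynomial.C (if j.2 = 0 then 1 else 0)

theorem evalOne_localCoord (j : Idx) : evalOne (localCoord j) = 0 := by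
  have : (Pi.single j.1 1 = j.2 + Pi.single j.1 1) ↔ j.2 = 0 := by
    rw [eq_comm]; simp
  simp [evalOne, localCoord, this]

theorem evalOne_matrixAction_localCoord (i j : Idx) :
    evalOne (matrixAction (dIdx i) (localCoord j)) = if i = j then 1 else 0 := by
  obtain ⟨i, α⟩ := i
  obtain ⟨j, β⟩ := j
  rw [localCoord, map_sub, MvPolynomial.derivation_C, sub_zero, matrixAction,
    MvPolynomial.mkDerivation_X, dIdx, d_apply_single, matrixCoeff_single]
  by_cases h : i = j
  · subst h
    simp [evalOne]
  · simp [h]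

/-- The independence half of the Poincaré–Birkhoff–Witt theorem for `Der ℂ[t₁^{±1}, t₂^{±1}]`.  No
ordering of the letters is needed: any choice of one word for each multiset will do. -/
theorem linearIndependent_words {α : Type*} {l : α → List Idx}
    (hl : Function.Injective fun a => (l a : Multiset Idx)) :
    LinearIndependent ℂ fun a =>
      ((l a).map fun j => UniversalEnvelopingAlgebra.ι ℂ (dIdx j)).prod := by
  have h := linearIndependent_words_of_derivations (D := fun j => matrixAction (dIdx j))
    evalOne_localCoord evalOne_matrixAction_localCoord hl
  apply LinearIndependent.of_comp (UniversalEnvelopingAlgebra.lift ℂ matrixRep).toLinearMap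
  have h2 : (UniversalEnvelopingAlgebra.lift ℂ matrixRep).toLinearMap ∘ (fun a =>
      ((l a).map fun j => UniversalEnvelopingAlgebra.ι ℂ (dIdx j)).prod) = fun a =>
      ((l a).map fun j => (matrixAction (dIdx j) : Module.End ℂ MatrixCoeff)).prod := by
    ext1 a
    rw [Function.comp_apply, AlgHom.toLinearMap_apply, map_list_prod, List.map_map]
    congr 2
    ext1 j
    exact UniversalEnvelopingAlgebra.lift_ι_apply ℂ matrixRep (dIdx j)
  rw [h2]
  exact h

theorem smul_euler_mem_span (i : Fin 2) (c : Laurent) :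
    c • euler i ∈ Submodule.span ℂ (Set.range dIdx) := by
  induction c using AddMonoidAlgebra.induction_linear with
  | zero => rw [zero_smul]; exact zero_mem _
  | add f g hf hg => rw [add_smul]; exact add_mem hf hg
  | single α r =>
    have : (AddMonoidAlgebra.single α r : Laurent) = r • AddMonoidAlgebra.single α 1 := by simp
    rw [this, smul_assoc]
    exact Submodule.smul_mem _ _ (Submodule.subset_span ⟨(i, α), rfl⟩)

/-- A derivation `D` is determined by its logarithmic derivatives `t^{-β} D(t^β)`, which are
additive in `β`. -/
def logDeriv (D : Der) : (Fin 2 → ℤ) →+ Laurent where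
  toFun β := AddMonoidAlgebra.single (-β) 1 * D (AddMonoidAlgebra.single β 1)
  map_zero' := by
    rw [← AddMonoidAlgebra.one_def, Derivation.map_one_eq_zero, mul_zero]
  map_add' β γ := by
    have h1 : ∀ β γ : Fin 2 → ℤ, (AddMonoidAlgebra.single (β + γ) 1 : Laurent) =
        AddMonoidAlgebra.single β 1 * AddMonoidAlgebra.single γ 1 := fun β γ => by
      rw [AddMonoidAlgebra.single_mul_single, one_mul]
    have h2 : ∀ β : Fin 2 → ℤ, (AddMonoidAlgebra.single (-β) 1 : Laurent) *
        AddMonoidAlgebra.single β 1 = 1 := fun β => by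
      rw [← h1, neg_add_cancel, AddMonoidAlgebra.one_def]
    rw [neg_add, h1, h1, Derivation.leibniz, smul_eq_mul, smul_eq_mul]
    linear_combination
      (AddMonoidAlgebra.single (-γ) 1 * D (AddMonoidAlgebra.single γ 1)) * h2 β +
      (AddMonoidAlgebra.single (-β) 1 * D (AddMonoidAlgebra.single β 1)) * h2 γ

theorem apply_single_eq_logDeriv (D : Der) (β : Fin 2 → ℤ) :
    D (AddMonoidAlgebra.single β 1) = AddMonoidAlgebra.single β 1 * logDeriv D β := by
  change _ = AddMonoidAlgebra.single β 1 *
    (AddMonoidAlgebra.single (-β) 1 * D (AddMonoidAlgebra.single β 1))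
  rw [← mul_assoc, AddMonoidAlgebra.single_mul_single, add_neg_cancel, one_mul,
    ← AddMonoidAlgebra.one_def, one_mul]

theorem span_dIdx : Submodule.span ℂ (Set.range dIdx) = ⊤ := by
  rw [eq_top_iff]
  rintro D -
  have h : D = logDeriv D (Pi.single 0 1) • euler 0 + logDeriv D (Pi.single 1 1) • euler 1 := by
    apply Derivation.ext
    intro f
    induction f using AddMonoidAlgebra.induction_linear with
    | zero => simp
    | add f g hf hg => simp only [map_add, hf, hg]
    | single β c =>
      have h1 : (AddMonoidAlgebra.single β c : Laurent) = c • AddMonoidAlgebra.single β 1 := by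
        simp
      have h2 : β = β 0 • Pi.single 0 1 + β 1 • Pi.single 1 1 := by
        ext i
        fin_cases i <;> simp
      have h3 : ∀ i, euler i (AddMonoidAlgebra.single β 1) =
          ((β i : ℤ) : Laurent) * AddMonoidAlgebra.single β 1 := fun i => by
        change eulerLinear i _ = _
        rw [eulerLinear_single, ← zsmul_eq_mul (AddMonoidAlgebra.single β (1 : ℂ)),
          ← Int.cast_smul_eq_zsmul ℂ, AddMonoidAlgebra.smul_single, smul_eq_mul]
      rw [h1, Derivation.map_smul, Derivation.map_smul]
      congr 1
      rw [apply_single_eq_logDeriv, Derivation.add_apply, Derivation.smul_apply,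
        Derivation.smul_apply, h3, h3, smul_eq_mul, smul_eq_mul]
      nth_rewrite 2 [h2]
      rw [map_add, map_zsmul, map_zsmul, zsmul_eq_mul, zsmul_eq_mul]
      ring
  rw [h]
  exact add_mem (smul_euler_mem_span 0 _) (smul_euler_mem_span 1 _)

/-! ### The structure of `W_ψ` -/

section EnvelopingSpan

variable {K L J : Type*} [Field K] [LieRing L] [LieAlgebra K L] {e : J → L}

theorem mem_span_words_of_span_eq_top (he : Submodule.span K (Set.range e) = ⊤)
    (u : UniversalEnvelopingAlgebra K L) :
    u ∈ Submodule.span K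
      (Set.range fun l : List J => (l.map fun j => UniversalEnvelopingAlgebra.ι K (e j)).prod) := by
  let A : Subalgebra K (UniversalEnvelopingAlgebra K L) :=
    Algebra.adjoin K (Set.range fun j => UniversalEnvelopingAlgebra.ι K (e j))
  have hA : ∀ x : L, UniversalEnvelopingAlgebra.ι K x ∈ A := by
    intro x
    have hx : x ∈ Submodule.span K (Set.range e) := he ▸ Submodule.mem_top
    induction hx using Submodule.span_induction with
    | mem x hx =>
      obtain ⟨j, rfl⟩ := hx
      exact Algebra.subset_adjoin ⟨j, rfl⟩
    | zero => rw [map_zero]; exact zero_mem _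
    | add x y _ _ hx hy => rw [map_add]; exact add_mem hx hy
    | smul c x _ hx => rw [map_smul]; exact Subalgebra.smul_mem _ hx c
  let g : L →ₗ⁅K⁆ A :=
    { toFun x := ⟨UniversalEnvelopingAlgebra.ι K x, hA x⟩
      map_add' x y := Subtype.ext (by simp only [map_add]; rfl)
      map_smul' c x := Subtype.ext (by simp only [map_smul]; rfl)
      map_lie' {x y} := Subtype.ext (by
        change UniversalEnvelopingAlgebra.ι K ⁅x, y⁆ = _
        rw [LieHom.map_lie, LieRing.of_associative_ring_bracket]; rfl) }
  have hg : A.val.comp (UniversalEnvelopingAlgebra.lift K g) = AlgHom.id K _ := by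
    apply UniversalEnvelopingAlgebra.hom_ext
    ext x
    exact congrArg Subtype.val (UniversalEnvelopingAlgebra.lift_ι_apply K g x)
  have hu : u ∈ A := by
    rw [← AlgHom.id_apply (R := K) u, ← hg]
    exact (UniversalEnvelopingAlgebra.lift K g u).2
  rw [← Subalgebra.mem_toSubmodule, Algebra.adjoin_eq_span] at hu
  refine Submodule.span_mono ?_ hu
  intro x hx
  obtain ⟨l, hl, rfl⟩ := Submonoid.exists_list_of_mem_closure hx
  have hl : l ∈ Set.range (List.map fun j => UniversalEnvelopingAlgebra.ι K (e j)) := by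
    rw [Set.range_list_map]
    exact hl
  obtain ⟨m, rfl⟩ := hl
  exact ⟨m, rfl⟩

theorem commutatorsLower_of_span_eq_top (he : Submodule.span K (Set.range e) = ⊤) :
    CommutatorsLower K (fun j => UniversalEnvelopingAlgebra.ι K (e j)) Set.univ fun _ => 1 := by
  intro i _ j _
  rw [← LieRing.of_associative_ring_bracket, ← LieHom.map_lie]
  have h : ⁅e i, e j⁆ ∈ Submodule.span K (Set.range e) := he ▸ Submodule.mem_top
  have h2 := Submodule.mem_map_of_mem
    (f := (UniversalEnvelopingAlgebra.ι K : L →ₗ⁅K⁆ _).toLinearMap) h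
  rw [Submodule.map_span] at h2
  refine Submodule.span_mono ?_ h2
  rintro _ ⟨_, ⟨k, rfl⟩, rfl⟩
  exact ⟨k, Set.mem_univ _, by norm_num, rfl⟩

/-- The enveloping algebra is spanned by any set of words that contains a rearrangement of every
word. -/
theorem span_words_eq_top (he : Submodule.span K (Set.range e) = ⊤)
    {T : Set (List J)} (hT : ∀ l : List J, ∃ l' ∈ T, l.Perm l') :
    Submodule.span K
      ((fun l : List J => (l.map fun j => UniversalEnvelopingAlgebra.ι K (e j)).prod) '' T) =
        ⊤ := by
  rw [eq_top_iff]
  rintro u -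
  refine Submodule.span_le.2 ?_ (mem_span_words_of_span_eq_top he u)
  rintro _ ⟨l, rfl⟩
  exact word_mem_span_of_perm (commutatorsLower_of_span_eq_top he) hT l

end EnvelopingSpan

theorem lexNonpos_or_lexPos (α : Fin 2 → ℤ) : LexNonpos α ∨ LexPos α := by
  by_cases h : α = 0
  · exact Or.inl (Or.inl h)
  · have : ¬ (α 0 = 0 ∧ α 1 = 0) := fun h' => h (by ext i; fin_cases i; exacts [h'.1, h'.2])
    simp only [LexNonpos, LexPos, Pi.neg_apply, h, false_or]
    omega

theorem lexPos_iff_not_lexNonpos (α : Fin 2 → ℤ) : LexPos α ↔ ¬ LexNonpos α := by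
  refine ⟨?_, (lexNonpos_or_lexPos α).resolve_left⟩
  rintro h (rfl | h')
  · simp [LexPos] at h
  · simp only [LexPos, Pi.neg_apply] at *
    omega

/-- The indices of the basis elements of `𝔟⁻`. -/
def negIdx : Set Idx := {j | LexNonpos j.2}

/-- The indices of the basis elements of `𝓛⁺`. -/
def posIdx : Set Idx := {j | LexPos j.2}

theorem mem_posIdx_iff {j : Idx} : j ∈ posIdx ↔ j ∉ negIdx :=
  lexPos_iff_not_lexNonpos j.2

/-- The basis elements of `𝔟⁻`. -/
def dNeg (b : negIdx) : bminus :=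
  ⟨dIdx b, Submodule.subset_span ⟨b.1.1, b.1.2, b.2, rfl⟩⟩

/-- The basis elements of `𝓛⁺`. -/
def dPos (n : posIdx) : Lplus :=
  ⟨dIdx n, Submodule.subset_span ⟨n.1.1, n.1.2, n.2, rfl⟩⟩

theorem span_dNeg : Submodule.span ℂ (Set.range dNeg) = ⊤ := by
  rw [eq_top_iff]
  rintro ⟨x, hx⟩ -
  have hx' : x ∈ Submodule.span ℂ {x | ∃ i, ∃ α ∈ {α | LexNonpos α}, d i α = x} := hx
  have : x ∈ (Submodule.span ℂ (Set.range dNeg)).map bminus.toSubmodule.subtype := by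
    rw [Submodule.map_span]
    refine Submodule.span_mono ?_ hx'
    rintro _ ⟨i, α, hα, rfl⟩
    exact ⟨dNeg ⟨(i, α), hα⟩, ⟨_, rfl⟩, rfl⟩
  obtain ⟨y, hy, rfl⟩ := this
  exact hy

theorem span_dPos : Submodule.span ℂ (Set.range dPos) = ⊤ := by
  rw [eq_top_iff]
  rintro ⟨x, hx⟩ -
  have hx' : x ∈ Submodule.span ℂ {x | ∃ i, ∃ α ∈ {α | LexPos α}, d i α = x} := hx
  have : x ∈ (Submodule.span ℂ (Set.range dPos)).map Lplus.toSubmodule.subtype := by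
    rw [Submodule.map_span]
    refine Submodule.span_mono ?_ hx'
    rintro _ ⟨i, α, hα, rfl⟩
    exact ⟨dPos ⟨(i, α), hα⟩, ⟨_, rfl⟩, rfl⟩
  obtain ⟨y, hy, rfl⟩ := this
  exact hy

/-- The monomial in the basis of `𝔟⁻` with given factors, in a fixed order. -/
def wordNeg (S : Multiset negIdx) : UniversalEnvelopingAlgebra ℂ bminus :=
  (S.toList.map fun b => UniversalEnvelopingAlgebra.ι ℂ (dNeg b)).prod

/-- The monomial in the basis of `𝓛⁺` with given factors, in a fixed order. -/
def wordPos (T : Multiset posIdx) : UniversalEnvelopingAlgebra ℂ Lplus :=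
  (T.toList.map fun n => UniversalEnvelopingAlgebra.ι ℂ (dPos n)).prod

theorem span_wordNeg : Submodule.span ℂ (Set.range wordNeg) = ⊤ := by
  rw [← span_words_eq_top span_dNeg
    (T := Set.range fun S : Multiset negIdx => S.toList) fun l => ⟨_, ⟨(l : Multiset negIdx), rfl⟩,
      by rw [← Multiset.coe_eq_coe, Multiset.coe_toList]⟩, ← Set.range_comp]
  rfl

theorem span_wordPos : Submodule.span ℂ (Set.range wordPos) = ⊤ := by
  rw [← span_words_eq_top span_dPos
    (T := Set.range fun S : Multiset posIdx => S.toList) fun l => ⟨_, ⟨(l : Multiset posIdx), rfl⟩,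
      by rw [← Multiset.coe_eq_coe, Multiset.coe_toList]⟩, ← Set.range_comp]
  rfl

theorem envIncl_ι (𝔨 : LieSubalgebra ℂ Der) (x : 𝔨) :
    envIncl 𝔨 (UniversalEnvelopingAlgebra.ι ℂ x) = UniversalEnvelopingAlgebra.ι ℂ (x : Der) :=
  UniversalEnvelopingAlgebra.lift_ι_apply ℂ _ x

theorem envIncl_wordNeg (S : Multiset negIdx) : envIncl bminus (wordNeg S) =
    (S.toList.map fun b : negIdx => UniversalEnvelopingAlgebra.ι ℂ (dIdx b)).prod := by
  rw [wordNeg, map_list_prod, List.map_map]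
  congr 2
  ext1 b
  exact envIncl_ι _ _

theorem envIncl_wordPos (T : Multiset posIdx) : envIncl Lplus (wordPos T) =
    (T.toList.map fun n : posIdx => UniversalEnvelopingAlgebra.ι ℂ (dIdx n)).prod := by
  rw [wordPos, map_list_prod, List.map_map]
  congr 2
  ext1 b
  exact envIncl_ι _ _

/-- The word in the letters `S` followed by the letters `T`. -/
def splitList (x : Multiset negIdx × Multiset posIdx) : List Idx :=
  x.1.toList.map (↑) ++ x.2.toList.map (↑)

theorem splitList_injective :
    Function.Injective fun x => (splitList x : Multiset Idx) := by
  classical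
  have h : ∀ x, (splitList x : Multiset Idx) = x.1.map (↑) + x.2.map (↑) := fun x => by
    rw [splitList, ← Multiset.coe_add, ← Multiset.map_coe, ← Multiset.map_coe,
      Multiset.coe_toList, Multiset.coe_toList]
  have hN : ∀ S : Multiset negIdx, (S.map ((↑) : negIdx → Idx)).filter (· ∈ negIdx) = S.map (↑) :=
    fun S => Multiset.filter_eq_self.2 fun j hj => by
      obtain ⟨b, -, rfl⟩ := Multiset.mem_map.1 hj
      exact b.2
  have hN' : ∀ T : Multiset posIdx, (T.map ((↑) : posIdx → Idx)).filter (· ∈ negIdx) = 0 :=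
    fun S => Multiset.filter_eq_nil.2 fun j hj => by
      obtain ⟨b, -, rfl⟩ := Multiset.mem_map.1 hj
      exact mem_posIdx_iff.1 b.2
  rintro ⟨S, T⟩ ⟨S', T'⟩ hST
  simp only [h] at hST
  have h1 := congrArg (Multiset.filter (· ∈ negIdx)) hST
  rw [Multiset.filter_add, Multiset.filter_add, hN, hN, hN', hN', add_zero, add_zero] at h1
  rw [h1, add_right_inj] at hST
  rw [Multiset.map_injective Subtype.val_injective h1,
    Multiset.map_injective Subtype.val_injective hST]

theorem exists_perm_splitList (l : List Idx) : ∃ x, l.Perm (splitList x) := by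
  classical
  obtain ⟨S, hS⟩ : l.filter (· ∈ negIdx) ∈ Set.range (List.map ((↑) : negIdx → Idx)) := by
    rw [Set.range_list_map]
    intro j hj
    simpa using (List.mem_filter.1 hj).2
  obtain ⟨T, hT⟩ : l.filter (fun j => !(decide (j ∈ negIdx))) ∈
      Set.range (List.map ((↑) : posIdx → Idx)) := by
    rw [Set.range_list_map]
    intro j hj
    simpa [mem_posIdx_iff] using (List.mem_filter.1 hj).2
  refine ⟨(S, T), (List.filter_append_perm (· ∈ negIdx) l).symm.trans ?_⟩
  rw [← hS, ← hT]
  refine List.Perm.append (List.Perm.map _ ?_) (List.Perm.map _ ?_) <;>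
    rw [← Multiset.coe_eq_coe, Multiset.coe_toList]

theorem word_splitList (x : Multiset negIdx × Multiset posIdx) :
    ((splitList x).map fun j => UniversalEnvelopingAlgebra.ι ℂ (dIdx j)).prod =
      envIncl bminus (wordNeg x.1) * envIncl Lplus (wordPos x.2) := by
  rw [envIncl_wordNeg, envIncl_wordPos, splitList, List.map_append, List.prod_append,
    List.map_map, List.map_map]
  rfl

/-- The basis of `U(𝓛)` consisting of the products of a monomial of `U(𝔟⁻)` and a monomial of
`U(𝓛⁺)`. -/
def envBasis : Module.Basis (Multiset negIdx × Multiset posIdx) ℂ UDer :=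
  Module.Basis.mk (linearIndependent_words splitList_injective) (by
    rw [← span_words_eq_top span_dIdx (T := Set.range splitList) fun l =>
      (exists_perm_splitList l).imp' splitList fun x hx => ⟨⟨x, rfl⟩, hx⟩, ← Set.range_comp]
    rfl)

theorem envBasis_apply (x : Multiset negIdx × Multiset posIdx) :
    envBasis x = envIncl bminus (wordNeg x.1) * envIncl Lplus (wordPos x.2) := by
  rw [envBasis, Module.Basis.mk_apply, word_splitList]

variable (ψ : Lplus →ₗ⁅ℂ⁆ ℂ)

/-- The linear map `U(𝓛) → ℂ[X b : b ∈ negIdx]` that takes the product of a monomial of `U(𝔟⁻)`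
and an element `s` of `U(𝓛⁺)` to `ψ(s)` times the corresponding commutative monomial.  It factors through
`W_ψ`. -/
def envSymbol : UDer →ₗ[ℂ] MvPolynomial negIdx ℂ :=
  envBasis.constr ℂ fun x => UniversalEnvelopingAlgebra.lift ℂ ψ (wordPos x.2) •
    MvPolynomial.monomial (Multiset.toFinsupp x.1) 1

theorem envSymbol_wordNeg_mul (S : Multiset negIdx) (s : UniversalEnvelopingAlgebra ℂ Lplus) :
    envSymbol ψ (envIncl bminus (wordNeg S) * envIncl Lplus s) =
      UniversalEnvelopingAlgebra.lift ℂ ψ s • MvPolynomial.monomial (Multiset.toFinsupp S) 1 := by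
  have hs : s ∈ Submodule.span ℂ (Set.range wordPos) := span_wordPos ▸ Submodule.mem_top
  induction hs using Submodule.span_induction with
  | mem s hs =>
    obtain ⟨T, rfl⟩ := hs
    rw [← envBasis_apply (S, T), envSymbol, Module.Basis.constr_basis]
  | zero => simp
  | add x y _ _ hx hy => simp only [map_add, mul_add, hx, hy, add_smul]
  | smul c x _ hx => rw [map_smul, mul_smul_comm, map_smul, hx, map_smul, smul_assoc]

theorem envSymbol_mul (u : UDer) (s : UniversalEnvelopingAlgebra ℂ Lplus) :
    envSymbol ψ (u * envIncl Lplus s) = UniversalEnvelopingAlgebra.lift ℂ ψ s • envSymbol ψ u := by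
  have hu : u ∈ Submodule.span ℂ (Set.range envBasis) := envBasis.span_eq ▸ Submodule.mem_top
  induction hu using Submodule.span_induction with
  | mem u hu =>
    obtain ⟨x, rfl⟩ := hu
    rw [envBasis_apply, mul_assoc, ← map_mul, envSymbol_wordNeg_mul, envSymbol_wordNeg_mul,
      map_mul, smul_smul, mul_comm]
  | zero => simp
  | add x y _ _ hx hy => simp only [map_add, add_mul, hx, hy, smul_add]
  | smul c x _ hx => rw [smul_mul_assoc, map_smul, hx, map_smul, smul_comm]

theorem smul_cyclicVector (u : UDer) :
    u • cyclicVector ψ = (balancingRelations ψ).mkQ (u ⊗ₜ[ℂ] (1 : ℂ)) := by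
  rw [cyclicVector]
  refine ((balancingRelations ψ).mkQ.map_smul u _).symm.trans ?_
  rw [TensorProduct.smul_tmul', smul_eq_mul, mul_one]

theorem envSymbol_eq_zero {u : UDer} (hu : u • cyclicVector ψ = 0) : envSymbol ψ u = 0 := by
  rw [smul_cyclicVector] at hu
  have hu : u ⊗ₜ[ℂ] (1 : ℂ) ∈ balancingRelations ψ := (Submodule.Quotient.mk_eq_zero _).1 hu
  -- The relations generate a left submodule, so the claim has to be proved for all left multiples.
  suffices h : ∀ y ∈ balancingRelations ψ, ∀ a : UDer,
      envSymbol ψ (TensorProduct.rid ℂ UDer (a • y)) = 0 by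
    simpa using h _ hu 1
  intro y hy
  induction hy using Submodule.span_induction with
  | mem y hy =>
    obtain ⟨u, s, c, rfl⟩ := hy
    intro a
    rw [smul_sub, TensorProduct.smul_tmul', TensorProduct.smul_tmul', smul_eq_mul, smul_eq_mul,
      ← mul_assoc, map_sub, map_sub, TensorProduct.rid_tmul, TensorProduct.rid_tmul, map_smul,
      map_smul, envSymbol_mul, smul_smul, mul_comm, sub_self]
  | zero => simp
  | add x y _ _ hx hy => intro a; rw [smul_add, map_add, map_add, hx, hy, add_zero]
  | smul b x _ hx => intro a; rw [smul_smul, hx]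

theorem exists_smul_cyclicVector (v : Whittaker ψ) : ∃ u : UDer, u • cyclicVector ψ = v := by
  obtain ⟨y, rfl⟩ := (balancingRelations ψ).mkQ_surjective v
  induction y using TensorProduct.induction_on with
  | zero => exact ⟨0, by rw [zero_smul, map_zero]; rfl⟩
  | tmul u c =>
    refine ⟨c • u, ?_⟩
    rw [smul_cyclicVector, TensorProduct.smul_tmul, smul_eq_mul, mul_one]
  | add x y hx hy =>
    obtain ⟨a, ha⟩ := hx
    obtain ⟨b, hb⟩ := hy
    exact ⟨a + b, by rw [add_smul, ha, hb, map_add]; rfl⟩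

theorem ι_smul_cyclicVector (x : Lplus) :
    UniversalEnvelopingAlgebra.ι ℂ (x : Der) • cyclicVector ψ = ψ x • cyclicVector ψ := by
  rw [smul_cyclicVector, cyclicVector]
  have h : (balancingRelations ψ).mkQ (UniversalEnvelopingAlgebra.ι ℂ (x : Der) ⊗ₜ[ℂ] (1 : ℂ)) =
      (balancingRelations ψ).mkQ (ψ x • ((1 : UDer) ⊗ₜ[ℂ] (1 : ℂ))) := by
    refine (Submodule.Quotient.eq _).2 (Submodule.subset_span
      ⟨1, UniversalEnvelopingAlgebra.ι ℂ x, 1, ?_⟩)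
    rw [envIncl_ι, one_mul, UniversalEnvelopingAlgebra.lift_ι_apply, mul_one,
      ← TensorProduct.tmul_smul, smul_eq_mul, mul_one]
  exact h.trans ((balancingRelations ψ).mkQ.map_smul_of_tower (ψ x) _)

theorem envIncl_smul_of_forall {v : Whittaker ψ}
    (hv : ∀ x : Lplus, UniversalEnvelopingAlgebra.ι ℂ (x : Der) • v = ψ x • v)
    (s : UniversalEnvelopingAlgebra ℂ Lplus) :
    envIncl Lplus s • v = UniversalEnvelopingAlgebra.lift ℂ ψ s • v := by
  have hs := mem_span_words_of_span_eq_top span_dPos s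
  induction hs using Submodule.span_induction with
  | mem s hs =>
    obtain ⟨l, rfl⟩ := hs
    induction l with
    | nil => simp
    | cons n l ih =>
      simp only [List.map_cons, List.prod_cons, map_mul, mul_smul] at ih ⊢
      rw [ih, envIncl_ι, smul_algebra_smul_comm, hv, UniversalEnvelopingAlgebra.lift_ι_apply,
        smul_comm]
  | zero => simp
  | add x y _ _ hx hy => simp only [map_add, add_smul, hx, hy]
  | smul c x _ hx => rw [map_smul, smul_assoc, hx, map_smul, smul_assoc]

/-- The universal property of `W_ψ`, for maps to itself. -/
theorem exists_endomorphism {v : Whittaker ψ}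
    (hv : ∀ x : Lplus, UniversalEnvelopingAlgebra.ι ℂ (x : Der) • v = ψ x • v) :
    ∃ θ : Whittaker ψ →ₗ[UDer] Whittaker ψ, θ (cyclicVector ψ) = v := by
  let g : UDer ⊗[ℂ] ℂ →ₗ[UDer] Whittaker ψ :=
    LinearMap.toSpanSingleton UDer (Whittaker ψ) v ∘ₗ
      (TensorProduct.AlgebraTensorModule.rid ℂ UDer UDer).toLinearMap
  have hg : ∀ (u : UDer) (c : ℂ), g (u ⊗ₜ c) = (c • u) • v := fun u c => by simp [g]
  have hle : balancingRelations ψ ≤ LinearMap.ker g := by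
    refine Submodule.span_le.2 ?_
    rintro _ ⟨u, s, c, rfl⟩
    rw [SetLike.mem_coe, LinearMap.mem_ker, map_sub, hg, hg, smul_assoc, mul_smul,
      envIncl_smul_of_forall ψ hv, smul_assoc, smul_algebra_smul_comm, smul_smul, mul_comm,
      sub_self]
  refine ⟨(balancingRelations ψ).liftQ g hle, ?_⟩
  rw [cyclicVector]
  refine ((balancingRelations ψ).liftQ_apply g _).trans ?_
  rw [hg, one_smul, one_smul]

theorem envIncl_bminus_smul_cyclicVector_eq_zero {u : UniversalEnvelopingAlgebra ℂ bminus}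
    (hu : envIncl bminus u • cyclicVector ψ = 0) : u = 0 := by
  have h : u ∈ Submodule.span ℂ (Set.range wordNeg) := span_wordNeg ▸ Submodule.mem_top
  obtain ⟨c, rfl⟩ := Finsupp.mem_span_range_iff_exists_finsupp.1 h
  have h1 := envSymbol_eq_zero ψ hu
  have h2 : ∀ S, envSymbol ψ (envIncl bminus (wordNeg S)) =
      MvPolynomial.monomial (Multiset.toFinsupp S) 1 := fun S => by
    simpa using envSymbol_wordNeg_mul ψ S 1
  simp only [Finsupp.sum, map_sum, map_smul, h2] at h1
  have h3 := ((MvPolynomial.basisMonomials negIdx ℂ).linearIndependent.comp _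
    Multiset.toFinsupp.injective)
  have h4 : c = 0 := by
    refine linearIndependent_iff.1 h3 c ?_
    rw [← h1, Finsupp.linearCombination_apply, Finsupp.sum]
    simp
  simp [h4]

/-- The parametrization of `W_ψ` by commutative polynomials. -/
def ofPoly : MvPolynomial negIdx ℂ →ₗ[ℂ] Whittaker ψ :=
  ofSymbol (fun j => UniversalEnvelopingAlgebra.ι ℂ (dIdx j)) (cyclicVector ψ) ℂ negIdx

theorem ofPoly_injective : Function.Injective (ofPoly ψ) := by
  rw [injective_iff_map_eq_zero]
  intro p hp
  let g := ofSymbol (fun j => UniversalEnvelopingAlgebra.ι ℂ (dIdx j)) (1 : UDer) ℂ negIdx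
  have h1 : ∀ p, ofPoly ψ p = g p • cyclicVector ψ := by
    intro p
    induction p using MvPolynomial.induction_on' with
    | monomial s c =>
      have : MvPolynomial.monomial s c = c • MvPolynomial.monomial s (1 : ℂ) := by
        rw [MvPolynomial.smul_monomial, smul_eq_mul, mul_one]
      rw [this, map_smul, map_smul, ofPoly, ofSymbol_monomial, ofSymbol_monomial, smul_assoc,
        smul_eq_mul, mul_one]
    | add p q hp hq => rw [map_add, map_add, add_smul, hp, hq]
  have h2 : ∀ p, envSymbol ψ (g p) = p := by
    intro p
    induction p using MvPolynomial.induction_on' with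
    | monomial s c =>
      have : MvPolynomial.monomial s c = c • MvPolynomial.monomial s (1 : ℂ) := by
        rw [MvPolynomial.smul_monomial, smul_eq_mul, mul_one]
      have h3 := envSymbol_wordNeg_mul ψ (Finsupp.toMultiset s) 1
      rw [map_one, mul_one, map_one, one_smul, envIncl_wordNeg,
        Finsupp.toMultiset_toFinsupp] at h3
      rw [this, map_smul, map_smul, ofSymbol_monomial, smul_eq_mul, mul_one, h3]
    | add p q hp hq => rw [map_add, map_add, hp, hq]
  rw [← h2 p]
  exact envSymbol_eq_zero ψ (h1 p ▸ hp)

open Classical in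
/-- The values of `ψ` on the basis elements of `𝓛⁺`, extended by zero to all indices. -/
def charValue (j : Idx) : ℂ := if h : j ∈ posIdx then ψ (dPos ⟨j, h⟩) else 0

theorem charValue_of_mem {j : Idx} (h : j ∈ posIdx) : charValue ψ j = ψ (dPos ⟨j, h⟩) :=
  dif_pos h

theorem ι_dIdx_smul_cyclicVector (j : Idx) (hj : j ∉ negIdx) :
    UniversalEnvelopingAlgebra.ι ℂ (dIdx j) • cyclicVector ψ =
      charValue ψ j • cyclicVector ψ := by
  have h := mem_posIdx_iff.2 hj
  rw [charValue_of_mem ψ h]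
  exact ι_smul_cyclicVector ψ (dPos ⟨j, h⟩)

theorem ofPoly_surjective : Function.Surjective (ofPoly ψ) := by
  intro v
  obtain ⟨u, rfl⟩ := exists_smul_cyclicVector ψ v
  have hu := mem_span_words_of_span_eq_top span_dIdx u
  rw [← LinearMap.mem_range]
  induction hu using Submodule.span_induction with
  | mem u hu =>
    obtain ⟨l, rfl⟩ := hu
    exact LinearMap.map_le_range (wordFiltration_le_map (commutatorsLower_of_span_eq_top span_dIdx)
      (ι_dIdx_smul_cyclicVector ψ) _ (word_mem_wordFiltration (by simp) (Nat.lt_succ_self _)))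
  | zero => rw [zero_smul]; exact zero_mem _
  | add x y _ _ hx hy => rw [add_smul]; exact add_mem hx hy
  | smul c x _ hx => rw [smul_assoc]; exact Submodule.smul_mem _ _ hx

/-! ### Derivations of polynomial rings -/

section PolynomialDerivations

open MvPolynomial

variable {K σ : Type*} [Field K] {g : σ → MvPolynomial σ K}

theorem notMem_vars_of_pderiv_eq_zero [CharZero K] {p : MvPolynomial σ K} {i : σ}
    (h : pderiv i p = 0) : i ∉ p.vars := by
  intro hi
  obtain ⟨s, hs, his⟩ := (mem_vars_iff_mem_support i).1 hi
  have h1 := coeff_pderiv (i := i) p (s - Finsupp.single i 1)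
  have h2 : s - Finsupp.single i 1 + Finsupp.single i 1 = s :=
    Finsupp.sub_add_single_one_cancel (Finsupp.mem_support_iff.1 his)
  rw [h, coeff_zero, h2, eq_comm, mul_eq_zero] at h1
  refine h1.elim (mem_support_iff.1 hs) ?_
  exact Nat.cast_add_one_ne_zero _

/-- A derivation that shifts the weights of the variables by `c` shifts the weights of all
polynomials by `c`. -/
theorem weightedHomogeneousComponent_mkDerivation {ω : σ → ℤ} {c : ℤ}
    (hg : ∀ i, IsWeightedHomogeneous ω (g i) (ω i + c)) (p : MvPolynomial σ K) (m : ℤ) :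
    weightedHomogeneousComponent ω (m + c) (mkDerivation K g p) =
      mkDerivation K g (weightedHomogeneousComponent ω m p) := by
  induction p using MvPolynomial.induction_on' with
  | monomial s a =>
    have h1 : mkDerivation K g (monomial s a) ∈
        weightedHomogeneousSubmodule K ω (Finsupp.weight ω s + c) := by
      rw [mkDerivation_monomial]
      refine Submodule.smul_mem _ _ (Submodule.sum_mem _ fun i hi => ?_)
      have h2 : Finsupp.weight ω (s - Finsupp.single i 1) + ω i = Finsupp.weight ω s := by
        conv_rhs => rw [← Finsupp.sub_add_single_one_cancel (Finsupp.mem_support_iff.1 hi)]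
        rw [map_add, Finsupp.weight_single, one_smul]
      simp only [mem_weightedHomogeneousSubmodule, smul_eq_mul]
      rw [← h2, add_assoc]
      exact (isWeightedHomogeneous_monomial ω _ _ rfl).mul (hg i)
    have h3 : monomial s a ∈ weightedHomogeneousSubmodule K ω (Finsupp.weight ω s) :=
      isWeightedHomogeneous_monomial ω _ _ rfl
    rw [weightedHomogeneousComponent_of_mem h1, weightedHomogeneousComponent_of_mem h3]
    by_cases h : m = Finsupp.weight ω s
    · rw [if_pos h, if_pos (by rw [h])]
    · rw [if_neg h, if_neg (by rwa [add_left_inj]), map_zero]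
  | add p q hp hq => simp only [map_add, hp, hq]

/-- A derivation that strictly raises weights has no nonzero eigenvalues. -/
theorem eq_zero_of_mkDerivation_eq_smul {ω : σ → ℤ} {c : ℤ} (hc : 0 < c)
    (hg : ∀ i, IsWeightedHomogeneous ω (g i) (ω i + c)) {p : MvPolynomial σ K} (hp : p ≠ 0)
    {a : K} (h : mkDerivation K g p = a • p) : a = 0 := by
  obtain ⟨s, hs, hmin⟩ := Finset.exists_min_image p.support (Finsupp.weight ω)
    (support_nonempty.2 hp)
  have h1 := weightedHomogeneousComponent_mkDerivation hg p (Finsupp.weight ω s - c)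
  have h2 : weightedHomogeneousComponent ω (Finsupp.weight ω s - c) p = 0 := by
    apply weightedHomogeneousComponent_eq_zero'
    intro t ht
    have := hmin t ht
    omega
  rw [h2, map_zero, sub_add_cancel, h, map_smul, smul_eq_zero] at h1
  refine h1.resolve_right fun h3 => ?_
  have h4 := congrArg (coeff s) h3
  rw [coeff_weightedHomogeneousComponent, if_pos rfl, coeff_zero] at h4
  exact mem_support_iff.1 hs h4

/-- If a derivation kills `p`, and `X i₀` is the only variable of `p` on which it has a nonzero
coefficient at a variable `X i₁` that does not occur in `p`, then `p` does not involve `X i₀`. -/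
theorem notMem_vars_of_mkDerivation_eq_zero [CharZero K] [DecidableEq σ] {p : MvPolynomial σ K}
    (h : mkDerivation K g p = 0) {i₀ i₁ : σ} (hi₁ : i₁ ∉ p.vars) {a : K} (ha : a ≠ 0)
    (hg : ∀ i ∈ p.vars, pderiv i₁ (g i) = if i = i₀ then C a else 0) : i₀ ∉ p.vars := by
  apply notMem_vars_of_pderiv_eq_zero
  have h1 : ⁅pderiv (R := K) i₁, mkDerivation K g⁆ p = 0 := by
    rw [Derivation.commutator_apply, h, pderiv_eq_zero_of_notMem_vars hi₁, map_zero, map_zero,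
      sub_zero]
  have h2 : ⁅pderiv (R := K) i₁, mkDerivation K g⁆ p = (a • pderiv i₀) p := by
    refine derivation_eq_of_forall_mem_vars fun i hi => ?_
    rw [Derivation.commutator_apply, mkDerivation_X, hg i hi,
      pderiv_X_of_ne (ne_of_mem_of_not_mem hi hi₁), map_zero, Derivation.smul_apply,
      pderiv_X, Pi.single_apply]
    by_cases h3 : i = i₀ <;> simp [h3, smul_eq_C_mul]
  rw [h2, Derivation.smul_apply, smul_eq_zero] at h1
  exact h1.resolve_left ha

/-- If a derivation kills `p`, then `p` does not involve a variable `X i₀` that is the only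
variable of `p` not killed by the derivation and is sent to a nonzero constant. -/
theorem notMem_vars_of_mkDerivation_eq_zero_of_const [CharZero K] [DecidableEq σ]
    {p : MvPolynomial σ K} (h : mkDerivation K g p = 0) {i₀ : σ} {a : K} (ha : a ≠ 0)
    (hg : ∀ i ∈ p.vars, g i = if i = i₀ then C a else 0) : i₀ ∉ p.vars := by
  apply notMem_vars_of_pderiv_eq_zero
  have h2 : mkDerivation K g p = (a • pderiv i₀) p := by
    refine derivation_eq_of_forall_mem_vars fun i hi => ?_
    rw [mkDerivation_X, hg i hi, Derivation.smul_apply, pderiv_X, Pi.single_apply]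
    by_cases h3 : i = i₀ <;> simp [h3, smul_eq_C_mul]
  rw [h2, Derivation.smul_apply, smul_eq_zero] at h
  exact h.resolve_left ha

/-- The derivation `X i ↦ a i X i` multiplies a monomial by its weight. -/
theorem coeff_mkDerivation_smul_X (ω : σ → ℤ) (p : MvPolynomial σ K) (s : σ →₀ ℕ) :
    coeff s (mkDerivation K (fun i => (ω i : K) • X i) p) =
      (Finsupp.weight ω s : K) * coeff s p := by
  classical
  induction p using MvPolynomial.induction_on' with
  | monomial t a =>
    have h : mkDerivation K (fun i => (ω i : K) • X i) (monomial t a) =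
        (Finsupp.weight ω t : K) • monomial t a := by
      rw [mkDerivation_monomial, Finsupp.weight_apply, Finsupp.sum, Finsupp.sum, Int.cast_sum,
        Finset.sum_smul, Finset.smul_sum]
      refine Finset.sum_congr rfl fun i hi => ?_
      rw [smul_eq_mul, mul_smul_comm, X, monomial_mul,
        Finsupp.sub_add_single_one_cancel (Finsupp.mem_support_iff.1 hi), smul_monomial,
        smul_monomial, smul_monomial]
      congr 1
      simp
      ring
    rw [h, coeff_smul, coeff_monomial, smul_eq_mul]
    split_ifs with h1
    · rw [h1]
    · simp
  | add p q hp hq => rw [map_add, coeff_add, coeff_add, hp, hq, mul_add]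

theorem weightedHomogeneousComponent_eq_zero_of_mem_lowExponents {J : Type*} {A B : Set J}
    {f : J → ℕ} {r : ℕ} {p : MvPolynomial B K} (hp : p ∈ restrictSupport K (lowExponents A f B r))
    {m : ℤ} (hm : (r : ℤ) ≤ m) :
    weightedHomogeneousComponent (fun b : B => (f b : ℤ)) m p = 0 := by
  apply weightedHomogeneousComponent_eq_zero'
  intro s hs
  have h1 := ((mem_restrictSupport_iff K).1 hp hs).2
  have h2 : Finsupp.weight (fun b : B => (f b : ℤ)) s =
      (Finsupp.weight (fun b : B => f b) s : ℕ) := by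
    simp [Finsupp.weight_apply, Finsupp.sum]
  omega

end PolynomialDerivations

/-! ### Values of characters of `𝓛⁺` -/

section Character

variable (ψ : Lplus →ₗ⁅ℂ⁆ ℂ)

theorem char_lie (x y : Lplus) : ψ ⁅x, y⁆ = 0 := by
  rw [LieHom.map_lie, LieRing.of_associative_ring_bracket, mul_comm, sub_self]

/-- The values of a character on two basis elements satisfy the relation coming from their
bracket. -/
theorem charValue_relation {i j : Fin 2} {α β : Fin 2 → ℤ} (hα : LexPos α) (hβ : LexPos β) :
    (β i : ℂ) * charValue ψ (j, α + β) = (α j : ℂ) * charValue ψ (i, α + β) := by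
  have hαβ := lexPos_add hα hβ
  have h := char_lie ψ (dPos ⟨(i, α), hα⟩) (dPos ⟨(j, β), hβ⟩)
  have h2 : ⁅dPos ⟨(i, α), hα⟩, dPos ⟨(j, β), hβ⟩⁆ =
      (β i : ℂ) • dPos ⟨(j, α + β), hαβ⟩ - (α j : ℂ) • dPos ⟨(i, α + β), hαβ⟩ :=
    Subtype.ext (d_lie_d i j α β)
  rw [h2, map_sub, map_smul, map_smul, sub_eq_zero, smul_eq_mul, smul_eq_mul] at h
  rwa [charValue_of_mem ψ (j := (j, α + β)) hαβ, charValue_of_mem ψ (j := (i, α + β)) hαβ]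

theorem charValue_eq_zero_of_pos (j : Fin 2) {α : Fin 2 → ℤ} (hα : 0 < α 0) :
    charValue ψ (j, α) = 0 := by
  have h1 : LexPos ![0, 1] := by simp [LexPos]
  have h2 : LexPos (α - ![0, 1]) := by simp [LexPos, hα]
  have h3 : (α 0 : ℂ) ≠ 0 := by exact_mod_cast hα.ne'
  have h := fun j => charValue_relation ψ (i := 0) (j := j) h1 h2
  simp only [add_sub_cancel] at h
  have h0 : charValue ψ (0, α) = 0 := by simpa [h3] using h 0
  have h1 : charValue ψ (1, α) = 0 := by simpa [h3, h0] using h 1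
  fin_cases j
  exacts [h0, h1]

theorem charValue_zero_eq_zero {k : ℤ} (hk : 2 ≤ k) : charValue ψ (0, ![0, k]) = 0 := by
  have h1 : LexPos ![0, 1] := by simp [LexPos]
  have h2 : LexPos ![0, k - 1] := by simp [LexPos]; omega
  have h := charValue_relation ψ (i := 1) (j := 0) h1 h2
  have h3 : ((k : ℂ) - 1) ≠ 0 := by
    have : k - 1 ≠ 0 := by omega
    exact_mod_cast this
  simpa [h3] using h

theorem charValue_zero_one_ne_zero (hψ : Nonsingular ψ) : charValue ψ (0, ![0, 1]) ≠ 0 := by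
  rw [charValue_of_mem ψ (j := (0, ![0, 1])) (by simp [posIdx, LexPos])]
  exact hψ.1

end Character

/-! ### The action on symbols -/

section Action

open MvPolynomial

variable (ψ : Lplus →ₗ⁅ℂ⁆ ℂ)

/-- The symbol of the commutator of `d_i(α)` and `d_j(β)`, where `n = (i, α)` and
`b = (j, β)`. -/
def bracketSymbol (f : Idx → ℕ) (n b : Idx) : MvPolynomial negIdx ℂ :=
  (b.2 n.1 : ℂ) • letterSymbol f (charValue ψ) negIdx (b.1, n.2 + b.2) -
    (n.2 b.1 : ℂ) • letterSymbol f (charValue ψ) negIdx (n.1, n.2 + b.2)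

theorem commutator_bracketSymbol_mem {A : Set Idx} {f : Idx → ℕ} {n b : Idx}
    (h₁ : b.2 n.1 ≠ 0 → (b.1, n.2 + b.2) ∈ A ∧ f (b.1, n.2 + b.2) < f n + f b)
    (h₂ : n.2 b.1 ≠ 0 → (n.1, n.2 + b.2) ∈ A ∧ f (n.1, n.2 + b.2) < f n + f b) :
    (UniversalEnvelopingAlgebra.ι ℂ (dIdx n) * UniversalEnvelopingAlgebra.ι ℂ (dIdx b) -
      UniversalEnvelopingAlgebra.ι ℂ (dIdx b) * UniversalEnvelopingAlgebra.ι ℂ (dIdx n),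
      bracketSymbol ψ f n b) ∈
      Submodule.span ℂ {x : UDer × MvPolynomial negIdx ℂ | ∃ k ∈ A, f k < f n + f b ∧
        (UniversalEnvelopingAlgebra.ι ℂ (dIdx k), letterSymbol f (charValue ψ) negIdx k) = x} := by
  have h : (UniversalEnvelopingAlgebra.ι ℂ (dIdx n) * UniversalEnvelopingAlgebra.ι ℂ (dIdx b) -
      UniversalEnvelopingAlgebra.ι ℂ (dIdx b) * UniversalEnvelopingAlgebra.ι ℂ (dIdx n),
      bracketSymbol ψ f n b) =
      (b.2 n.1 : ℂ) • (UniversalEnvelopingAlgebra.ι ℂ (dIdx (b.1, n.2 + b.2)),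
        letterSymbol f (charValue ψ) negIdx (b.1, n.2 + b.2)) -
      (n.2 b.1 : ℂ) • (UniversalEnvelopingAlgebra.ι ℂ (dIdx (n.1, n.2 + b.2)),
        letterSymbol f (charValue ψ) negIdx (n.1, n.2 + b.2)) := by
    refine Prod.ext ?_ rfl
    rw [← LieRing.of_associative_ring_bracket, ← LieHom.map_lie, dIdx, dIdx, d_lie_d, map_sub,
      map_smul, map_smul]
    rfl
  rw [h]
  refine sub_mem ?_ ?_
  · by_cases h0 : b.2 n.1 = 0
    · rw [h0, Int.cast_zero, zero_smul]; exact zero_mem _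
    · exact Submodule.smul_mem _ _ (Submodule.subset_span ⟨_, (h₁ h0).1, (h₁ h0).2, rfl⟩)
  · by_cases h0 : n.2 b.1 = 0
    · rw [h0, Int.cast_zero, zero_smul]; exact zero_mem _
    · exact Submodule.smul_mem _ _ (Submodule.subset_span ⟨_, (h₂ h0).1, (h₂ h0).2, rfl⟩)

/-- If `d_i(α)`, with `n = (i, α)` and `α > 0`, multiplies the vector with polynomial `p` by the
scalar `a`, then, up to lower terms, `p` is an eigenvector of the derivation with values `g`. -/
theorem smul_sub_mkDerivation_mem {A : Set Idx} {f : Idx → ℕ}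
    (hE : CommutatorsLower ℂ (fun j => UniversalEnvelopingAlgebra.ι ℂ (dIdx j)) A f)
    {n : Idx} (hn : n ∈ posIdx) {g : negIdx → MvPolynomial negIdx ℂ}
    (hg : ∀ b : negIdx, (b : Idx) ∈ A →
      g b = bracketSymbol ψ f n b ∧
      (b.1.2 n.1 ≠ 0 → (b.1.1, n.2 + b.1.2) ∈ A ∧ f (b.1.1, n.2 + b.1.2) < f n + f b) ∧
      (n.2 b.1.1 ≠ 0 → (n.1, n.2 + b.1.2) ∈ A ∧ f (n.1, n.2 + b.1.2) < f n + f b))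
    {r : ℕ} {p : MvPolynomial negIdx ℂ}
    (hp : p ∈ restrictSupport ℂ (lowExponents A f negIdx (r + 1))) {a : ℂ}
    (ha : UniversalEnvelopingAlgebra.ι ℂ (dIdx n) • ofPoly ψ p = a • ofPoly ψ p) :
    (a - charValue ψ n) • p - mkDerivation ℂ g p ∈
      restrictSupport ℂ (lowExponents A f negIdx (r + f n - 1)) := by
  have h := smul_ofSymbol_sub_mem_map hE (ι_dIdx_smul_cyclicVector ψ) (mem_posIdx_iff.1 hn)
    (g := g) (fun b hb => by
      rw [(hg b hb).1]
      exact commutator_bracketSymbol_mem ψ (hg b hb).2.1 (hg b hb).2.2) hp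
  rw [← ofPoly, ha, ← sub_smul, ← map_smul, ← map_sub] at h
  obtain ⟨q, hq, hq'⟩ := h
  rwa [← ofPoly_injective ψ hq']

variable {ψ}

theorem isWeightedHomogeneous_letterSymbol {f : Idx → ℕ} {χ : Idx → ℂ} {ω : negIdx → ℤ} {m : ℤ}
    {j : Idx} (h₁ : ∀ h : j ∈ negIdx, ω ⟨j, h⟩ = m) (h₂ : f j = 0 → m = 0) :
    IsWeightedHomogeneous ω (letterSymbol f χ negIdx j) m := by
  rw [letterSymbol]
  split_ifs with h h'
  · rw [← h₁ h]; exact isWeightedHomogeneous_X ℂ _ _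
  · rw [h₂ h']; exact isWeightedHomogeneous_C _ _
  · exact isWeightedHomogeneous_zero _ _ _

theorem isWeightedHomogeneous_bracketSymbol {f : Idx → ℕ} {ω : negIdx → ℤ} {m : ℤ} {n b : Idx}
    (h₁ : b.2 n.1 ≠ 0 → (∀ h : (b.1, n.2 + b.2) ∈ negIdx, ω ⟨_, h⟩ = m) ∧
      (f (b.1, n.2 + b.2) = 0 → m = 0))
    (h₂ : n.2 b.1 ≠ 0 → (∀ h : (n.1, n.2 + b.2) ∈ negIdx, ω ⟨_, h⟩ = m) ∧
      (f (n.1, n.2 + b.2) = 0 → m = 0)) :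
    IsWeightedHomogeneous ω (bracketSymbol ψ f n b) m := by
  rw [← mem_weightedHomogeneousSubmodule, bracketSymbol]
  refine sub_mem ?_ ?_
  · by_cases h0 : b.2 n.1 = 0
    · rw [h0, Int.cast_zero, zero_smul]; exact zero_mem _
    · exact Submodule.smul_mem _ _ (isWeightedHomogeneous_letterSymbol (h₁ h0).1 (h₁ h0).2)
  · by_cases h0 : n.2 b.1 = 0
    · rw [h0, Int.cast_zero, zero_smul]; exact zero_mem _
    · exact Submodule.smul_mem _ _ (isWeightedHomogeneous_letterSymbol (h₂ h0).1 (h₂ h0).2)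

theorem pderiv_letterSymbol {f : Idx → ℕ} {χ : Idx → ℂ} (i : negIdx) (j : Idx) :
    pderiv i (letterSymbol f χ negIdx j) = if j = i then 1 else 0 := by
  classical
  by_cases h : j ∈ negIdx
  · rw [letterSymbol_of_mem h, pderiv_X, Pi.single_apply]
    simp only [Subtype.ext_iff]
  · have h' : j ≠ i := fun h' => h (by rw [h']; exact i.2)
    rw [letterSymbol, dif_neg h, if_neg h']
    split_ifs
    exacts [pderiv_C, map_zero _]

/-- The component of top weight of a nonzero polynomial. -/
theorem exists_top_component {A : Set Idx} (f : Idx → ℕ) {p : MvPolynomial negIdx ℂ} (hp : p ≠ 0)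
    (hA : ∀ b ∈ p.vars, (b : Idx) ∈ A) :
    ∃ r : ℕ, p ∈ restrictSupport ℂ (lowExponents A f negIdx (r + 1)) ∧
      weightedHomogeneousComponent (fun b : negIdx => (f b : ℤ)) r p ≠ 0 := by
  obtain ⟨s, hs, hmax⟩ := Finset.exists_max_image p.support
    (Finsupp.weight fun b : negIdx => f b) (support_nonempty.2 hp)
  refine ⟨Finsupp.weight (fun b : negIdx => f b) s, ?_, fun h => ?_⟩
  · rw [mem_restrictSupport_iff]
    exact fun t ht => ⟨fun b hb => hA b ((mem_vars_iff_mem_support b).2 ⟨t, ht, hb⟩),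
      Nat.lt_succ_of_le (hmax t ht)⟩
  · have h1 := congrArg (coeff s) h
    rw [coeff_weightedHomogeneousComponent, if_pos, coeff_zero] at h1
    · exact mem_support_iff.1 hs h1
    · simp [Finsupp.weight_apply, Finsupp.sum]

theorem support_component_subset {ω : negIdx → ℤ} {m : ℤ} {p : MvPolynomial negIdx ℂ} :
    (weightedHomogeneousComponent ω m p).support ⊆ p.support := by
  intro s hs
  rw [mem_support_iff, coeff_weightedHomogeneousComponent] at hs
  rw [mem_support_iff]
  exact fun h => hs (by rw [h, ite_self])

/-- The leading symbol of a common eigenvector of `𝓛⁺` in `W_ψ` is a common eigenvector of the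
action of `𝓛⁺` on `S(𝓛/𝓛⁺)`. -/
theorem exists_symbol_eigenvector {p : MvPolynomial negIdx ℂ} (hp : p ≠ 0) {a : Idx → ℂ}
    (ha : ∀ n ∈ posIdx,
      UniversalEnvelopingAlgebra.ι ℂ (dIdx n) • ofPoly ψ p = a n • ofPoly ψ p) :
    ∃ q : MvPolynomial negIdx ℂ, q ≠ 0 ∧ q.support ⊆ p.support ∧ ∀ n ∈ posIdx,
      mkDerivation ℂ (fun b : negIdx => bracketSymbol ψ (fun _ => 1) n b) q =
        (a n - charValue ψ n) • q := by
  obtain ⟨r, hr, hq⟩ := exists_top_component (A := Set.univ) (fun _ => 1) hp (by simp)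
  refine ⟨_, hq, support_component_subset, fun n hn => ?_⟩
  have h1 := smul_sub_mkDerivation_mem ψ (commutatorsLower_of_span_eq_top span_dIdx) hn
    (g := fun b => bracketSymbol ψ (fun _ => 1) n b) (by simp) hr (ha n hn)
  have h2 := weightedHomogeneousComponent_eq_zero_of_mem_lowExponents h1
    (m := (r : ℤ) + 0) (by simp)
  rw [map_sub, weightedHomogeneousComponent_mkDerivation, map_smul, add_zero, sub_eq_zero] at h2
  · exact h2.symm
  · intro b
    exact isWeightedHomogeneous_bracketSymbol (by simp) (by simp)

theorem eq_of_symbol_eigenvector {q : MvPolynomial negIdx ℂ} (hq : q ≠ 0) {n : Idx}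
    (hn : n ∈ posIdx) {c : ℂ}
    (h : mkDerivation ℂ (fun b : negIdx => bracketSymbol ψ (fun _ => 1) n b) q = c • q) :
    c = 0 := by
  -- The derivation raises the weight given by the scalar product with the degree of `n`.
  have hpos : 0 < n.2 0 * n.2 0 + n.2 1 * n.2 1 := by
    rcases hn with h | ⟨h0, h⟩
    · nlinarith [mul_self_nonneg (n.2 1)]
    · nlinarith [mul_self_nonneg (n.2 0)]
  refine eq_zero_of_mkDerivation_eq_smul
    (ω := fun b : negIdx => b.1.2 0 * n.2 0 + b.1.2 1 * n.2 1) hpos (fun b => ?_) hq h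
  have h3 : (n.2 + b.1.2) 0 * n.2 0 + (n.2 + b.1.2) 1 * n.2 1 =
      b.1.2 0 * n.2 0 + b.1.2 1 * n.2 1 + (n.2 0 * n.2 0 + n.2 1 * n.2 1) := by
    simp only [Pi.add_apply]
    ring
  exact isWeightedHomogeneous_bracketSymbol (fun _ => ⟨fun _ => h3, by simp⟩)
    (fun _ => ⟨fun _ => h3, by simp⟩)

/-- A symbol killed by all `d₁(0, k)`, `k > 0`, involves only variables of degree `(0, m)`:
for large `k`, the operator `d₁(0, k)` moves each of the other variables to a new variable. -/
theorem fst_eq_zero_of_mem_vars {q : MvPolynomial negIdx ℂ}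
    (h : ∀ k : ℤ, 0 < k →
      mkDerivation ℂ (fun b : negIdx => bracketSymbol ψ (fun _ => 1) (0, ![0, k]) b) q = 0)
    {b : negIdx} (hb : b ∈ q.vars) : b.1.2 0 = 0 := by
  classical
  by_contra hb0
  obtain ⟨M, hM⟩ := Finset.exists_le (q.vars.image fun b : negIdx => |b.1.2 1|)
  have hM : ∀ b ∈ q.vars, |b.1.2 1| ≤ M := fun b hb => hM _ (Finset.mem_image_of_mem _ hb)
  have hMb := hM b hb
  obtain ⟨⟨i, α⟩, hα⟩ := b
  have hneg : α 0 < 0 := by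
    have : LexNonpos α := hα
    rcases this with h' | h'
    · exact absurd (congrFun h' 0) hb0
    · simp only [LexPos, Pi.neg_apply] at h'
      simp only at hb0
      omega
  have hmem : ∀ (j : Fin 2) (k : ℤ), (j, ![0, k] + α) ∈ negIdx := fun j k => by
    right
    left
    simp only [Pi.neg_apply, Pi.add_apply, Matrix.cons_val_zero]
    omega
  have hα0 : (α 0 : ℂ) ≠ 0 := by exact_mod_cast hneg.ne
  set k : ℤ := 2 * M + 1 with hk
  have habs := abs_le.1 hMb
  simp only at habs
  have hnew : ∀ j : Fin 2, (⟨(j, ![0, k] + α), hmem j k⟩ : negIdx) ∉ q.vars := fun j hj => by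
    have := abs_le.1 (hM _ hj)
    simp at this
    omega
  have hD := h k (by omega)
  have hpd : ∀ (j : Fin 2) (c : negIdx),
      pderiv (⟨(j, ![0, k] + α), hmem j k⟩ : negIdx)
        (bracketSymbol ψ (fun _ => 1) (0, ![0, k]) c) =
      (c.1.2 0 : ℂ) • (if c.1 = (j, α) then 1 else 0) -
        ((![0, k] : Fin 2 → ℤ) c.1.1 : ℂ) • (if j = 0 ∧ c.1.2 = α then 1 else 0) := by
    rintro j ⟨⟨i', γ⟩, hγ⟩
    rw [bracketSymbol, map_sub, Derivation.map_smul, Derivation.map_smul, pderiv_letterSymbol,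
      pderiv_letterSymbol]
    simp only [Prod.mk.injEq, add_right_inj, eq_comm (a := (0 : Fin 2))]
  have h1 : (⟨(1, α), hα⟩ : negIdx) ∉ q.vars := by
    refine notMem_vars_of_mkDerivation_eq_zero hD (hnew 1) hα0 fun c hc => ?_
    rw [hpd]
    by_cases hc' : c.1 = (1, α)
    · have : c = ⟨(1, α), hα⟩ := Subtype.ext hc'
      subst this
      simp [smul_eq_C_mul]
    · rw [if_neg hc', if_neg (by simp), if_neg fun h => hc' (congrArg Subtype.val h)]
      simp
  have h0 : (⟨(0, α), hα⟩ : negIdx) ∉ q.vars := by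
    refine notMem_vars_of_mkDerivation_eq_zero hD (hnew 0) hα0 fun c hc => ?_
    rw [hpd]
    by_cases hc' : c.1 = (0, α)
    · have : c = ⟨(0, α), hα⟩ := Subtype.ext hc'
      subst this
      simp [smul_eq_C_mul]
    · have h2 : ¬ (c.1.2 = α) := by
        obtain ⟨⟨i', γ⟩, hγ⟩ := c
        rintro rfl
        fin_cases i'
        · exact hc' rfl
        · exact h1 hc
      rw [if_neg hc', if_neg (by simp [h2]), if_neg fun h => hc' (congrArg Subtype.val h)]
      simp
  fin_cases i
  exacts [h0 hb, h1 hb]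

end Action

/-! ### Whittaker vectors -/

section WhittakerVectors

open MvPolynomial

variable {ψ : Lplus →ₗ⁅ℂ⁆ ℂ}

theorem forall_smul_eq_of_basis {v : Whittaker ψ} {ψ' : Lplus →ₗ⁅ℂ⁆ ℂ}
    (h : ∀ n ∈ posIdx, UniversalEnvelopingAlgebra.ι ℂ (dIdx n) • v = charValue ψ' n • v)
    (x : Lplus) : UniversalEnvelopingAlgebra.ι ℂ (x : Der) • v = ψ' x • v := by
  have hx : x ∈ Submodule.span ℂ (Set.range dPos) := span_dPos ▸ Submodule.mem_top
  induction hx using Submodule.span_induction with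
  | mem x hx =>
    obtain ⟨n, rfl⟩ := hx
    rw [← charValue_of_mem ψ' n.2]
    exact h n n.2
  | zero => simp
  | add x y _ _ hx hy =>
    rw [show ((x + y : Lplus) : Der) = x + y from rfl, map_add, map_add, add_smul,
      add_smul, hx, hy]
  | smul c x _ hx =>
    rw [show ((c • x : Lplus) : Der) = c • (x : Der) from rfl, map_smul, map_smul,
      smul_assoc, smul_assoc, hx]

theorem ι_d_zero_mul (j : Idx) :
    UniversalEnvelopingAlgebra.ι ℂ (d 0 0) * UniversalEnvelopingAlgebra.ι ℂ (dIdx j) =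
      UniversalEnvelopingAlgebra.ι ℂ (dIdx j) * UniversalEnvelopingAlgebra.ι ℂ (d 0 0) +
        (j.2 0 : ℂ) • UniversalEnvelopingAlgebra.ι ℂ (dIdx j) := by
  have h : ⁅d 0 0, dIdx j⁆ = (j.2 0 : ℂ) • dIdx j := by
    rw [dIdx, d_lie_d, Pi.zero_apply, Int.cast_zero, zero_smul, sub_zero, zero_add]
  rw [← map_smul, ← h, LieHom.map_lie, LieRing.of_associative_ring_bracket, add_sub_cancel]

/-- The operator `z` maps Whittaker vectors of type `ψ` to such vectors, as `ψ` vanishes in all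
degrees `α` with `α₁ ≠ 0`. -/
theorem smul_d_zero_smul {v : Whittaker ψ}
    (hv : ∀ x : Lplus, UniversalEnvelopingAlgebra.ι ℂ (x : Der) • v = ψ x • v) (x : Lplus) :
    UniversalEnvelopingAlgebra.ι ℂ (x : Der) • UniversalEnvelopingAlgebra.ι ℂ (d 0 0) • v =
      ψ x • UniversalEnvelopingAlgebra.ι ℂ (d 0 0) • v := by
  refine forall_smul_eq_of_basis (fun n hn => ?_) x
  have h1 : UniversalEnvelopingAlgebra.ι ℂ (dIdx n) • v = charValue ψ n • v := by
    rw [charValue_of_mem ψ hn]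
    exact hv (dPos ⟨n, hn⟩)
  have h2 : (n.2 0 : ℂ) * charValue ψ n = 0 := by
    rcases hn with h | h
    · exact mul_eq_zero_of_right _ (charValue_eq_zero_of_pos ψ n.1 h)
    · rw [h.1, Int.cast_zero, zero_mul]
  rw [← mul_smul, ← add_sub_cancel_right (UniversalEnvelopingAlgebra.ι ℂ (dIdx n) * _)
    ((n.2 0 : ℂ) • UniversalEnvelopingAlgebra.ι ℂ (dIdx n)), ← ι_d_zero_mul, sub_smul, mul_smul,
    smul_assoc, h1, smul_smul, h2, zero_smul, sub_zero, smul_algebra_smul_comm]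

/-- The grading of `W_ψ` by the first component of the degree, as an operator: it multiplies a
monomial by the sum of the first components of the degrees of its factors.  It is the difference
of the left and the right multiplication with `z`, and so preserves Whittaker vectors of type
`ψ`. -/
theorem exists_grading_operator (ψ : Lplus →ₗ⁅ℂ⁆ ℂ) :
    ∃ δ : Whittaker ψ → Whittaker ψ,
      (∀ v, (∀ x : Lplus, UniversalEnvelopingAlgebra.ι ℂ (x : Der) • v = ψ x • v) →
        ∀ x : Lplus, UniversalEnvelopingAlgebra.ι ℂ (x : Der) • δ v = ψ x • δ v) ∧
      ∀ p, δ (ofPoly ψ p) =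
        ofPoly ψ (mkDerivation ℂ
          (fun b : negIdx => (b.1.2 0 : ℂ) • (X b : MvPolynomial negIdx ℂ)) p) := by
  obtain ⟨θ, hθ⟩ := exists_endomorphism ψ (smul_d_zero_smul (ι_smul_cyclicVector ψ))
  refine ⟨fun v => UniversalEnvelopingAlgebra.ι ℂ (d 0 0) • v - θ v, fun v hv x => ?_, fun p => ?_⟩
  · simp only
    rw [smul_sub, smul_sub, smul_d_zero_smul hv, ← map_smul, hv, LinearMap.map_smul_of_tower]
  · have hword : ∀ l : List negIdx,
        UniversalEnvelopingAlgebra.ι ℂ (d 0 0) *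
          (l.map fun b : negIdx => UniversalEnvelopingAlgebra.ι ℂ (dIdx b)).prod =
        (l.map fun b : negIdx => UniversalEnvelopingAlgebra.ι ℂ (dIdx b)).prod *
          UniversalEnvelopingAlgebra.ι ℂ (d 0 0) +
        (((l.map fun b : negIdx => b.1.2 0).sum : ℤ) : ℂ) •
          (l.map fun b : negIdx => UniversalEnvelopingAlgebra.ι ℂ (dIdx b)).prod := by
      intro l
      induction l with
      | nil => simp
      | cons b l ih =>
        simp only [List.map_cons, List.prod_cons, List.sum_cons]
        rw [← mul_assoc, ι_d_zero_mul, add_mul, mul_assoc, ih, mul_add, mul_assoc, smul_mul_assoc,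
          mul_smul_comm, Int.cast_add, add_smul]
        abel
    induction p using MvPolynomial.induction_on' with
    | monomial s c =>
      have h1 : monomial s c = c • monomial s (1 : ℂ) := by
        rw [smul_monomial, smul_eq_mul, mul_one]
      have h2 : mkDerivation ℂ
          (fun b : negIdx => (b.1.2 0 : ℂ) • (X b : MvPolynomial negIdx ℂ)) (monomial s (1 : ℂ)) =
          ((Finsupp.weight (fun b : negIdx => b.1.2 0) s : ℤ) : ℂ) • monomial s 1 := by
        ext t
        rw [coeff_mkDerivation_smul_X (fun b : negIdx => b.1.2 0), coeff_smul, coeff_monomial,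
          smul_eq_mul]
        split_ifs with h
        · rw [h]
        · simp
      have h3 : ((Finsupp.toMultiset s).toList.map fun b : negIdx => b.1.2 0).sum =
          Finsupp.weight (fun b : negIdx => b.1.2 0) s := by
        rw [← Multiset.sum_coe, ← Multiset.map_coe, Multiset.coe_toList, Finsupp.toMultiset_map,
          Finsupp.weight_apply, Finsupp.sum_toMultiset,
          Finsupp.sum_mapDomain_index (by simp) (by simp [add_mul])]
      have h4 := congrArg (· • cyclicVector ψ) (hword (Finsupp.toMultiset s).toList)
      simp only [add_smul, mul_smul, smul_assoc] at h4
      rw [h1, Derivation.map_smul, h2]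
      simp only [map_smul, LinearMap.map_smul_of_tower]
      rw [smul_algebra_smul_comm, ← smul_sub]
      congr 1
      rw [ofPoly, ofSymbol_monomial, map_smul, hθ, h4, h3, add_sub_cancel_left]
    | add p q hp hq =>
      simp only [map_add, smul_add] at hp hq ⊢
      rw [← hp, ← hq]
      abel

/-- A Whittaker vector of type `ψ` is represented by a polynomial in the variables of degrees
`(0, m)`: its components in the other degrees would be Whittaker vectors without a possible
leading symbol. -/
theorem fst_eq_zero_of_whittaker {p : MvPolynomial negIdx ℂ}
    (hp : ∀ x : Lplus, UniversalEnvelopingAlgebra.ι ℂ (x : Der) • ofPoly ψ p = ψ x • ofPoly ψ p)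
    {b : negIdx} (hb : b ∈ p.vars) : b.1.2 0 = 0 := by
  obtain ⟨δ, hδ, hδp⟩ := exists_grading_operator ψ
  have h1 := hδ _ hp
  rw [hδp] at h1
  have h2 : mkDerivation ℂ
      (fun b : negIdx => (b.1.2 0 : ℂ) • (X b : MvPolynomial negIdx ℂ)) p = 0 := by
    by_contra hne
    obtain ⟨q, hq, hqs, hqn⟩ := exists_symbol_eigenvector (a := charValue ψ) hne fun n hn => by
      rw [charValue_of_mem ψ hn]
      exact h1 (dPos ⟨n, hn⟩)
    simp only [sub_self, zero_smul] at hqn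
    obtain ⟨s, hs⟩ := support_nonempty.2 hq
    have h3 := mem_support_iff.1 (hqs hs)
    rw [coeff_mkDerivation_smul_X (fun b : negIdx => b.1.2 0)] at h3
    refine h3 (mul_eq_zero_of_left ?_ _)
    rw [Int.cast_eq_zero, Finsupp.weight_apply]
    refine Finset.sum_eq_zero fun c hc => ?_
    change s c • c.1.2 0 = 0
    rw [fst_eq_zero_of_mem_vars (fun k hk => hqn _ (by simp [posIdx, LexPos, hk]))
      ((mem_vars_iff_mem_support c).2 ⟨s, hs, hc⟩), smul_zero]
  obtain ⟨s, hs, hbs⟩ := (mem_vars_iff_mem_support b).1 hb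
  have h3 := congrArg (coeff s) h2
  rw [coeff_mkDerivation_smul_X (fun b : negIdx => b.1.2 0), coeff_zero, mul_eq_zero] at h3
  have h4 := h3.resolve_right (mem_support_iff.1 hs)
  rw [Int.cast_eq_zero, Finsupp.weight_apply, Finsupp.sum,
    Finset.sum_eq_zero_iff_of_nonpos] at h4
  · have h5 := h4 b hbs
    rw [smul_eq_zero] at h5
    exact h5.resolve_left (Finsupp.mem_support_iff.1 hbs)
  · intro c _
    refine smul_nonpos_of_nonneg_of_nonpos (Nat.zero_le _) ?_
    rcases c.2 with h | h
    · rw [h]; rfl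
    · simp only [LexPos, Pi.neg_apply] at h
      omega

/-- In degrees `(0, m)`, the brackets lower the number of factors `d₂`, as the `d₁(0, m)`
commute. -/
theorem bracket_lower_of_fst_eq_zero {i j : Idx} (hi : i.2 0 = 0) (hj : j.2 0 = 0) :
    (j.2 i.1 ≠ 0 → (j.1, i.2 + j.2) ∈ {j : Idx | j.2 0 = 0} ∧ (j.1 : ℕ) < i.1 + j.1) ∧
    (i.2 j.1 ≠ 0 → (i.1, i.2 + j.2) ∈ {j : Idx | j.2 0 = 0} ∧ (i.1 : ℕ) < i.1 + j.1) := by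
  have h : (i.2 + j.2) 0 = 0 := by rw [Pi.add_apply, hi, hj, add_zero]
  obtain ⟨i, α⟩ := i
  obtain ⟨j, β⟩ := j
  simp only at hi hj h
  fin_cases i <;> fin_cases j <;> simp [hi, hj]

theorem commutatorsLower_of_fst_eq_zero :
    CommutatorsLower ℂ (fun j => UniversalEnvelopingAlgebra.ι ℂ (dIdx j))
      {j : Idx | j.2 0 = 0} (fun j => j.1) := by
  intro i hi j hj
  have h := Submodule.mem_map_of_mem (f := LinearMap.fst ℂ UDer (MvPolynomial negIdx ℂ))
    (commutator_bracketSymbol_mem 0 (f := fun j => j.1) (bracket_lower_of_fst_eq_zero hi hj).1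
      (bracket_lower_of_fst_eq_zero hi hj).2)
  rw [Submodule.map_span] at h
  refine Submodule.span_mono ?_ h
  rintro _ ⟨_, ⟨k, hk, hkf, rfl⟩, rfl⟩
  exact ⟨k, hk, hkf, rfl⟩

theorem letterSymbol_zero_of_pos {k : ℤ} (hk : 0 < k) :
    letterSymbol (fun j => j.1) (charValue ψ) negIdx (0, ![0, k]) =
      C (charValue ψ (0, ![0, k])) := by
  rw [letterSymbol, dif_neg (mem_posIdx_iff.1 (by simp [posIdx, LexPos, hk]))]
  exact if_pos rfl

/-- A Whittaker vector of type `ψ` is represented by a polynomial without the variables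
`d₂(0, -m)`: for the largest occurring `m`, the operator `d₁(0, m + 1)` sends this variable to a
multiple of `ψ(d₁(0, 1)) ≠ 0`, and the other variables of the leading symbol to zero. -/
theorem idx_eq_zero_of_whittaker (hψ : Nonsingular ψ) {p : MvPolynomial negIdx ℂ}
    (hp : ∀ x : Lplus, UniversalEnvelopingAlgebra.ι ℂ (x : Der) • ofPoly ψ p = ψ x • ofPoly ψ p)
    {b : negIdx} (hb : b ∈ p.vars) : b.1.1 = 0 := by
  classical
  have hvars : ∀ b ∈ p.vars, b.1.2 0 = 0 := fun b hb => fst_eq_zero_of_whittaker hp hb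
  have hp0 : p ≠ 0 := by rintro rfl; simp at hb
  obtain ⟨r, hr, hq⟩ := exists_top_component (A := {j : Idx | j.2 0 = 0}) (fun j => j.1) hp0 hvars
  set q := weightedHomogeneousComponent (fun b : negIdx => ((b.1.1 : ℕ) : ℤ)) r p with hqdef
  have hqp : q.support ⊆ p.support := support_component_subset
  have hqvars : ∀ b ∈ q.vars, b.1.2 0 = 0 := fun b hb => by
    obtain ⟨s, hs, hbs⟩ := (mem_vars_iff_mem_support b).1 hb
    exact hvars b ((mem_vars_iff_mem_support b).2 ⟨s, hqp hs, hbs⟩)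
  -- `r` is the largest number of factors `d₂` in a monomial of `p`.
  rcases Nat.eq_zero_or_pos r with rfl | hr0
  · obtain ⟨s, hs, hbs⟩ := (mem_vars_iff_mem_support b).1 hb
    have h1 := ((mem_restrictSupport_iff ℂ).1 hr hs).2
    have h2 := Finsupp.le_weight_of_ne_zero' (fun b : negIdx => (b.1.1 : ℕ))
      (Finsupp.mem_support_iff.1 hbs)
    exact Fin.ext (Nat.le_zero.1 (h2.trans (Nat.lt_succ_iff.1 h1)))
  exfalso
  obtain ⟨s, hs⟩ := support_nonempty.2 hq
  obtain ⟨c, hc, hc1⟩ : ∃ c ∈ q.vars, c.1.1 = 1 := by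
    have h1 : Finsupp.weight (fun b : negIdx => ((b.1.1 : ℕ) : ℤ)) s = r := by
      by_contra h
      rw [mem_support_iff, coeff_weightedHomogeneousComponent, if_neg h] at hs
      exact hs rfl
    by_contra! h
    have h2 : Finsupp.weight (fun b : negIdx => ((b.1.1 : ℕ) : ℤ)) s = 0 := by
      rw [Finsupp.weight_apply]
      refine Finset.sum_eq_zero fun c hc => ?_
      have h3 : c.1.1 ≠ 1 := h c ((mem_vars_iff_mem_support c).2 ⟨s, hs, hc⟩)
      have h4 : c.1.1 = 0 := by omega
      simp [h4]
    omega
  obtain ⟨b, hb', hmin⟩ := Finset.exists_min_image (q.vars.filter fun c => c.1.1 = 1)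
    (fun c => c.1.2 1) ⟨c, by simp [hc, hc1]⟩
  obtain ⟨hbq, hb1⟩ := Finset.mem_filter.1 hb'
  have hbneg : b.1.2 1 ≤ 0 := by
    rcases b.2 with h | h
    · rw [h]; rfl
    · have := hqvars b hbq
      simp only [LexPos, Pi.neg_apply] at h
      omega
  set k : ℤ := 1 - b.1.2 1 with hk
  have hn : ((0, ![0, k]) : Idx) ∈ posIdx := by
    simp only [posIdx, LexPos, Set.mem_ofPred_eq]
    right
    simp
    omega
  let g : negIdx → MvPolynomial negIdx ℂ := fun c =>
    if c.1.2 0 = 0 then bracketSymbol ψ (fun j => j.1) (0, ![0, k]) c else 0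
  have h1 := smul_sub_mkDerivation_mem ψ commutatorsLower_of_fst_eq_zero hn (g := g)
    (fun c hc => ⟨if_pos hc, bracket_lower_of_fst_eq_zero (i := (0, ![0, k])) rfl hc⟩) hr
    (a := charValue ψ (0, ![0, k])) (by
      rw [charValue_of_mem ψ hn]
      exact hp (dPos ⟨_, hn⟩))
  have hD : mkDerivation ℂ g q = 0 := by
    have h2 := weightedHomogeneousComponent_eq_zero_of_mem_lowExponents h1
      (m := (r : ℤ) + -1) (by simp; omega)
    rw [sub_self, zero_smul, zero_sub, map_neg, neg_eq_zero,
      weightedHomogeneousComponent_mkDerivation] at h2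
    · exact h2
    · intro c
      by_cases hc : c.1.2 0 = 0
      · simp only [g, if_pos hc]
        refine isWeightedHomogeneous_bracketSymbol (fun h => absurd hc h) fun h => ?_
        have hc1 : c.1.1 = 1 := by
          by_contra h'
          have : c.1.1 = 0 := by omega
          rw [this] at h
          exact h rfl
        simp [hc1]
      · simp only [g, if_neg hc]
        exact isWeightedHomogeneous_zero _ _ _
  have ha : -(k : ℂ) * charValue ψ (0, ![0, 1]) ≠ 0 := by
    refine mul_ne_zero (neg_ne_zero.2 ?_) (charValue_zero_one_ne_zero ψ hψ)
    have : k ≠ 0 := by omega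
    exact_mod_cast this
  refine notMem_vars_of_mkDerivation_eq_zero_of_const hD ha (fun c hc => ?_) hbq
  have hc0 := hqvars c hc
  simp only [g, if_pos hc0]
  by_cases hc1 : c.1.1 = 1
  · have hle := hmin c (Finset.mem_filter.2 ⟨hc, hc1⟩)
    have hdeg : ![0, k] + c.1.2 = ![0, k + c.1.2 1] := by
      ext i
      fin_cases i <;> simp [hc0]
    rw [bracketSymbol, hdeg, hc0, hc1, letterSymbol_zero_of_pos (by omega), Int.cast_zero,
      zero_smul, zero_sub]
    split_ifs with hcb
    · subst hcb
      have : k + c.1.2 1 = 1 := by omega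
      simp [this, smul_eq_C_mul]
    · have : c.1.2 1 ≠ b.1.2 1 := fun h => hcb (Subtype.ext (Prod.ext (hc1.trans hb1.symm) (by
        ext i
        fin_cases i
        · exact hc0.trans (hqvars b hbq).symm
        · exact h)))
      rw [charValue_zero_eq_zero ψ (by omega), C_0, smul_zero, neg_zero]
  · have hc2 : c.1.1 = 0 := by omega
    have hcb : c ≠ b := by rintro rfl; exact hc1 hb1
    rw [if_neg hcb, bracketSymbol, hc2, hc0]
    simp

/-- A Whittaker vector of type `ψ` is represented by a polynomial without the variables
`d₁(0, -m)`, `m > 0`: for the largest occurring `m`, the operator `d₂(0, m + 1)` sends this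
variable to a multiple of `ψ(d₁(0, 1)) ≠ 0`, and the other variables to zero. -/
theorem eq_zero_of_whittaker (hψ : Nonsingular ψ) {p : MvPolynomial negIdx ℂ}
    (hp : ∀ x : Lplus, UniversalEnvelopingAlgebra.ι ℂ (x : Der) • ofPoly ψ p = ψ x • ofPoly ψ p)
    {b : negIdx} (hb : b ∈ p.vars) : b.1 = (0, 0) := by
  classical
  have hvars : ∀ b ∈ p.vars, b.1.2 0 = 0 := fun b hb => fst_eq_zero_of_whittaker hp hb
  have hidx : ∀ b ∈ p.vars, b.1.1 = 0 := fun b hb => idx_eq_zero_of_whittaker hψ hp hb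
  obtain ⟨c, hc, hmin⟩ := Finset.exists_min_image p.vars (fun c => c.1.2 1) ⟨b, hb⟩
  have hneg : ∀ b ∈ p.vars, b.1.2 1 ≤ 0 := fun b hb => by
    rcases b.2 with h | h
    · rw [h]; rfl
    · have := hvars b hb
      simp only [LexPos, Pi.neg_apply] at h
      omega
  suffices h0 : c.1.2 1 = 0 by
    refine Prod.ext (hidx b hb) ?_
    ext i
    have h1 := hmin b hb
    have h2 := hneg b hb
    fin_cases i
    · exact hvars b hb
    · change b.1.2 1 = 0
      omega
  by_contra hc0
  have hcneg := hneg c hc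
  set k : ℤ := 1 - c.1.2 1 with hk
  have hn : ((1, ![0, k]) : Idx) ∈ posIdx := by
    simp only [posIdx, LexPos, Set.mem_ofPred_eq]
    right
    simp
    omega
  have hr : p ∈ restrictSupport ℂ
      (lowExponents {j : Idx | j.2 0 = 0} (fun j => j.1) negIdx (0 + 1)) := by
    rw [mem_restrictSupport_iff]
    intro s hs
    refine ⟨fun b hb => hvars b ((mem_vars_iff_mem_support b).2 ⟨s, hs, hb⟩), ?_⟩
    rw [zero_add, Nat.lt_one_iff, Finsupp.weight_apply]
    refine Finset.sum_eq_zero fun b hb => ?_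
    simp [hidx b ((mem_vars_iff_mem_support b).2 ⟨s, hs, hb⟩)]
  let g : negIdx → MvPolynomial negIdx ℂ := fun c => bracketSymbol ψ (fun j => j.1) (1, ![0, k]) c
  have h1 := smul_sub_mkDerivation_mem ψ commutatorsLower_of_fst_eq_zero hn (g := g)
    (fun c hc => ⟨rfl, bracket_lower_of_fst_eq_zero (i := (1, ![0, k])) rfl hc⟩) hr
    (a := charValue ψ (1, ![0, k])) (by
      rw [charValue_of_mem ψ hn]
      exact hp (dPos ⟨_, hn⟩))
  -- There are no exponents of negative weight, so there is no error term.
  have hD : mkDerivation ℂ g p = 0 := by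
    rw [sub_self, zero_smul, zero_sub, Submodule.neg_mem_iff, mem_restrictSupport_iff] at h1
    rw [← support_eq_empty, Finset.eq_empty_iff_forall_notMem]
    intro s hs
    have := (h1 hs).2
    simp at this
  have ha : (c.1.2 1 : ℂ) * charValue ψ (0, ![0, 1]) ≠ 0 :=
    mul_ne_zero (by exact_mod_cast hc0) (charValue_zero_one_ne_zero ψ hψ)
  refine notMem_vars_of_mkDerivation_eq_zero_of_const hD ha (fun e he => ?_) hc
  have he0 := hvars e he
  have hle := hmin e he
  have hdeg : ![0, k] + e.1.2 = ![0, k + e.1.2 1] := by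
    ext i
    fin_cases i <;> simp [he0]
  simp only [g]
  have hk0 : ((1, ![0, k]) : Idx).2 0 = 0 := rfl
  rw [bracketSymbol, hdeg, hidx e he, letterSymbol_zero_of_pos (by omega), hk0, Int.cast_zero,
    zero_smul, sub_zero]
  split_ifs with hec
  · subst hec
    have : k + e.1.2 1 = 1 := by omega
    rw [this, smul_eq_C_mul, ← C_mul]
  · have : e.1.2 1 ≠ c.1.2 1 := fun h => hec (Subtype.ext (Prod.ext
      ((hidx e he).trans (hidx c hc).symm) (by
        ext i
        fin_cases i
        · exact he0.trans (hvars c hc).symm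
        · exact h)))
    rw [charValue_zero_eq_zero ψ (by omega), C_0, smul_zero]

theorem exists_mem_adjoin_of_vars {p : MvPolynomial negIdx ℂ} (hp : ∀ b ∈ p.vars, b.1 = (0, 0)) :
    ∃ u ∈ Algebra.adjoin ℂ ({UniversalEnvelopingAlgebra.ι ℂ z} :
        Set (UniversalEnvelopingAlgebra ℂ bminus)),
      ofPoly ψ p = envIncl bminus u • cyclicVector ψ := by
  have h : ∀ s ∈ p.support, ofPoly ψ (monomial s 1) =
      envIncl bminus (UniversalEnvelopingAlgebra.ι ℂ z ^ (Finsupp.toMultiset s).toList.length) •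
        cyclicVector ψ := fun s hs => by
    rw [ofPoly, ofSymbol_monomial, map_pow, envIncl_ι]
    congr 1
    rw [← List.length_map (as := (Finsupp.toMultiset s).toList)
      (fun b : negIdx => UniversalEnvelopingAlgebra.ι ℂ (dIdx b))]
    refine List.prod_eq_pow_card _ _ fun x hx => ?_
    obtain ⟨b, hb, rfl⟩ := List.mem_map.1 hx
    rw [Multiset.mem_toList, Finsupp.mem_toMultiset] at hb
    rw [hp b ((mem_vars_iff_mem_support b).2 ⟨s, hs, hb⟩)]
    rfl
  have hz : UniversalEnvelopingAlgebra.ι ℂ z ∈ Algebra.adjoin ℂ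
      ({UniversalEnvelopingAlgebra.ι ℂ z} : Set (UniversalEnvelopingAlgebra ℂ bminus)) :=
    Algebra.subset_adjoin (Set.mem_singleton _)
  refine ⟨∑ s ∈ p.support, coeff s p •
    UniversalEnvelopingAlgebra.ι ℂ z ^ (Finsupp.toMultiset s).toList.length, ?_, ?_⟩
  · exact Subalgebra.sum_mem _ fun s _ => Subalgebra.smul_mem _ (Subalgebra.pow_mem _ hz _) _
  · conv_lhs => rw [p.as_sum]
    rw [map_sum, map_sum, Finset.sum_smul]
    refine Finset.sum_congr rfl fun s hs => ?_
    rw [map_smul, smul_assoc, ← h s hs, ← map_smul, smul_monomial, smul_eq_mul, mul_one]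

theorem whittaker_of_mem_adjoin {u : UniversalEnvelopingAlgebra ℂ bminus}
    (hu : u ∈ Algebra.adjoin ℂ ({UniversalEnvelopingAlgebra.ι ℂ z} :
      Set (UniversalEnvelopingAlgebra ℂ bminus))) (x : Lplus) :
    UniversalEnvelopingAlgebra.ι ℂ (x : Der) • envIncl bminus u • cyclicVector ψ =
      ψ x • envIncl bminus u • cyclicVector ψ := by
  rw [Algebra.adjoin_singleton_eq_range_aeval] at hu
  obtain ⟨P, rfl⟩ := hu
  induction P using Polynomial.induction_on' with
  | add p q hp hq =>
    simp only [AlgHom.toRingHom_eq_coe, RingHom.coe_coe, map_add, add_smul, smul_add] at hp hq ⊢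
    rw [hp, hq]
  | monomial n c =>
    have h : ∀ x : Lplus, UniversalEnvelopingAlgebra.ι ℂ (x : Der) •
        envIncl bminus (UniversalEnvelopingAlgebra.ι ℂ z ^ n) • cyclicVector ψ =
        ψ x • envIncl bminus (UniversalEnvelopingAlgebra.ι ℂ z ^ n) • cyclicVector ψ := by
      induction n with
      | zero => simpa using ι_smul_cyclicVector ψ
      | succ n ih =>
        rw [pow_succ', map_mul, envIncl_ι, mul_smul]
        exact smul_d_zero_smul ih
    simp only [AlgHom.toRingHom_eq_coe, RingHom.coe_coe, Polynomial.aeval_monomial,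
      ← Algebra.smul_def, map_smul, smul_assoc]
    rw [smul_algebra_smul_comm, h, smul_comm]

/-- A common eigenvector of `𝓛⁺` has the type `ψ`, as `𝓛⁺` strictly raises degrees in
`S(𝓛/𝓛⁺)`. -/
theorem eq_of_isWhittakerVectorOfType {ψ' : Lplus →ₗ⁅ℂ⁆ ℂ} {v : Whittaker ψ}
    (hv : IsWhittakerVectorOfType ψ' v) : ψ' = ψ := by
  obtain ⟨p, rfl⟩ := ofPoly_surjective ψ v
  obtain ⟨hv0, hv⟩ := hv
  have hp : p ≠ 0 := by rintro rfl; exact hv0 (map_zero _)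
  obtain ⟨q, hq, -, h⟩ := exists_symbol_eigenvector (a := charValue ψ') hp fun n hn => by
    rw [charValue_of_mem ψ' hn]
    exact hv (dPos ⟨n, hn⟩)
  have h1 : ∀ n : posIdx, ψ' (dPos n) = ψ (dPos n) := fun n => by
    have := eq_of_symbol_eigenvector hq n.2 (h n n.2)
    rwa [sub_eq_zero, charValue_of_mem ψ' n.2, charValue_of_mem ψ n.2] at this
  have h2 : (ψ' : Lplus →ₗ[ℂ] ℂ) = ψ :=
    LinearMap.ext_on_range span_dPos h1
  exact LieHom.ext fun x => LinearMap.congr_fun h2 x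

end WhittakerVectors

end DerTorus

end

theorem theorem3p2 (ψ : DerTorus.Lplus →ₗ⁅ℂ⁆ ℂ) (hψ : DerTorus.Nonsingular ψ) :
    (∀ u : UniversalEnvelopingAlgebra ℂ DerTorus.bminus, u ≠ 0 →
      (DerTorus.IsWhittakerVector
          (DerTorus.envIncl DerTorus.bminus u • DerTorus.cyclicVector ψ) ↔
        u ∈ Algebra.adjoin ℂ
          ({UniversalEnvelopingAlgebra.ι ℂ DerTorus.z} :
            Set (UniversalEnvelopingAlgebra ℂ DerTorus.bminus)))) ∧
    (∀ (ψ' : DerTorus.Lplus →ₗ⁅ℂ⁆ ℂ) (v : DerTorus.Whittaker ψ),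
      DerTorus.IsWhittakerVectorOfType ψ' v → ψ' = ψ) := by
  refine ⟨fun u hu => ⟨?_, fun h => ⟨ψ, ?_, ?_⟩⟩,
    fun ψ' v => DerTorus.eq_of_isWhittakerVectorOfType⟩
  · rintro ⟨ψ', h⟩
    obtain rfl := DerTorus.eq_of_isWhittakerVectorOfType h
    obtain ⟨p, hp⟩ := DerTorus.ofPoly_surjective ψ' (DerTorus.envIncl DerTorus.bminus u •
      DerTorus.cyclicVector ψ')
    rw [← hp] at h
    obtain ⟨u', hu', h'⟩ := DerTorus.exists_mem_adjoin_of_vars (ψ := ψ') fun b hb =>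
      DerTorus.eq_zero_of_whittaker hψ h.2 hb
    rw [hp, ← sub_eq_zero, ← sub_smul, ← map_sub] at h'
    rwa [sub_eq_zero.1 (DerTorus.envIncl_bminus_smul_cyclicVector_eq_zero ψ' h')]
  · exact fun h0 => hu (DerTorus.envIncl_bminus_smul_cyclicVector_eq_zero ψ h0)
  · exact DerTorus.whittaker_of_mem_adjoin h
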